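/- Let $H$ be a separable complex Hilbert space and $D$ a closed densely defined symmetric operator in $H$ with deficiency indices $(1,1)$; put $D_{\max}=D^*$, with graph scalar product $\langle\xi,\zeta\rangle_D=\langle\xi,\zeta\rangle+\langle D_{\max}\xi,D_{\max}\zeta\rangle$ (linear in the second variable). Let $\phi_\pm\in\operatorname{dom}(D_{\max})$ satisfy $D_{\max}\phi_\pm=\pm i\phi_\pm$ and $\langle\phi_\pm,\phi_\pm\rangle_D=1$, and put $\alpha_\pm(\xi)=\langle\phi_\pm,\xi\rangle_D$. For $\lambda\in S^1$ let $D_\lambda$ be the restriction of $D_{\max}$ to $\{\xi\in\operatorname{dom}(D_{\max}) : \alpha_+(\xi)=\lambda\,\alpha_-(\xi)\}$, and let $\eta_\lambda^\perp=\frac1{\sqrt2}(\phi_+-\overline\lambda\,\phi_-)$. Let $X$ be a locally compact Hausdorff space and let $E=C_0(X,H)$ be the Hilbert $C_0(X)$-module with $\langle f,g\rangle(x)=\langle f(x),g(x)\rangle$. Let $T_{\max}$ be the operator in $E$ with domain $C_0(X,\operatorname{dom}(D_{\max}))$ (graph norm on $\operatorname{dom}(D_{\max})$) and $(T_{\max}f)(x)=D_{\max}(f(x))$.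 For a Borel function $\Lambda:X\to S^1$ let $T_\Lambda$ be the restriction of $T_{\max}$ to those $f$ with $\alpha_+(f(x))=\Lambda(x)\,\alpha_-(f(x))$ for all $x\in X$; it is a closed semiregular operator. Let $\operatorname{reg}\Lambda$ be the set of points having a neighborhood on which $\Lambda$ is continuous. Let $\operatorname{reg}_\infty\Lambda$ be the set of $p\in\partial\operatorname{reg}\Lambda$ having an open neighborhood $U$ and a continuous $\tilde\Lambda:U\to S^1$ with $\tilde\Lambda=\Lambda$ on $U\cap\operatorname{reg}\Lambda$, and let $\operatorname{ssupp}_r\Lambda=\partial\operatorname{reg}\Lambda\setminus\operatorname{reg}_\infty\Lambda$. A closed operator $T$ in $E$ whose domain is a dense submodule and whose adjoint is densely defined is called regular if $I+T^*T$ has dense range. Assume that $\overline{\operatorname{reg}\Lambda}=X$, and let $\mu$ be a (Radon) probability measure on $X$ with $\operatorname{supp}\mu=X$ and $\mu(\partial\operatorname{reg}\Lambda)=0$. For a semiregular operator $T$ in $E$ let $T^\mu$ denote its localization, i.e. the closure in $L^2(X,\mu;H)$ of the operator $[f]\mapsto[Tf]$, $f\in\operatorname{dom}(T)$. Then the representation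 $\pi_\mu$ of $C_0(X)$ by multiplication operators (on $L^2(X,\mu)$, and on $L^2(X,\mu;H)$) is faithful, $T_\Lambda^\mu=(T_\Lambda^\mu)^*$, and $$\operatorname{dom}(T_\Lambda^\mu)=\{f\in\operatorname{dom}(T_{\max}^\mu) : f(x)\in\operatorname{dom}(D_{\Lambda(x)})\text{ for }\mu\text{-a.e. }x\}=\{f\in\operatorname{dom}(T_{\max}^\mu) : \langle f,\eta_\Lambda^\perp\rangle_{T,\mu}=0\ \mu\text{-a.e.}\},$$ where $\eta_\Lambda^\perp(x)=\eta_{\Lambda(x)}^\perp$ defines an element of $\operatorname{dom}(T_{\max}^\mu)$, and $\langle f,g\rangle_{T,\mu}$ is the function $x\mapsto\langle f(x),g(x)\rangle+\langle(T_{\max}^\mu f)(x),(T_{\max}^\mu g)(x)\rangle$. Moreover, if $\partial\operatorname{reg}\Lambda=\operatorname{ssupp}_r\Lambda\neq\emptyset$ then $T_\Lambda$ is selfadjoint but not regular, while if $\partial\operatorname{reg}\Lambda=\operatorname{reg}_\infty\Lambda\neq\emptyset$ then $T_\Lambda$ is neither selfadjoint nor regular (although $T_\Lambda^\mu$ is selfadjoint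 and $\pi_\mu$ is faithful). Thus there are closed semiregular operators $T_\Lambda$ that are not regular (selfadjoint ones, and also non-selfadjoint ones) whose localization at a faithful representation is selfadjoint; such $\Lambda$ exist for suitable $H$ and $D$ already for $X=[0,1]$ with Lebesgue measure. -/

import Mathlib

open MeasureTheory Topology Filter
open scoped ZeroAtInfty ENNReal

universe u v

noncomputable section

namespace ModuleLocalization

/-! ### Unbounded operators on a Hilbert space -/

section HilbertSpace

variable {H : Type u} [NormedAddCommGroup H] [InnerProductSpace ℂ H]

/-- The graph scalar product `⟨x, y⟩_T = ⟨x, y⟩ + ⟨T x, T y⟩` on the domain of `T`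
(linear in the second variable). -/
def graphInner (T : H →ₗ.[ℂ] H) (x y : T.domain) : ℂ :=
  inner ℂ (x : H) (y : H) + inner ℂ (T x) (T y)

/-- The functional `ξ ↦ ⟨φ, ξ⟩_T` on the domain of `T`. -/
def graphInnerLeft (T : H →ₗ.[ℂ] H) (φ : T.domain) : T.domain →ₗ[ℂ] ℂ where
  toFun ξ := graphInner T φ ξ
  map_add' x y := by
    simp only [graphInner, Submodule.coe_add, LinearPMap.map_add, inner_add_right]; ring
  map_smul' c x := by
    simp only [graphInner, Submodule.coe_smul, LinearPMap.map_smul, inner_smul_right,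
      RingHom.id_apply, smul_eq_mul]; ring

/-- The kernel of `T - z`. -/
def eigenspace (T : H →ₗ.[ℂ] H) (z : ℂ) : Submodule ℂ H :=
  T.graph.comap (LinearMap.prod LinearMap.id (z • LinearMap.id))

variable [CompleteSpace H]

variable (H) in
/-- A closed densely defined symmetric operator `D` with deficiency indices `(1, 1)`, together
with a choice of vectors `φ₊`, `φ₋` with `D^* φ± = ± i φ±`, normalized in the graph scalar product
of `D^*`. (Such vectors always exist; each is unique up to a phase.) -/
structure DeficiencyOne where
  D : H →ₗ.[ℂ] H
  dense_domain : Dense (D.domain : Set H)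
  closed : D.IsClosed
  symmetric : D ≤ D.adjoint
  deficiency_plus : Module.finrank ℂ (eigenspace D.adjoint Complex.I) = 1
  deficiency_minus : Module.finrank ℂ (eigenspace D.adjoint (-Complex.I)) = 1
  φp : D.adjoint.domain
  φm : D.adjoint.domain
  apply_φp : D.adjoint φp = Complex.I • (φp : H)
  apply_φm : D.adjoint φm = -Complex.I • (φm : H)
  norm_φp : graphInner D.adjoint φp φp = 1
  norm_φm : graphInner D.adjoint φm φm = 1

namespace DeficiencyOne

variable (B : DeficiencyOne H)

/-- `D_max = D^*`. -/
def Dmax : H →ₗ.[ℂ] H := B.D.adjoint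

/-- `α₊(ξ) = ⟨φ₊, ξ⟩_D`. -/
def αp : B.Dmax.domain →ₗ[ℂ] ℂ := graphInnerLeft B.Dmax B.φp

/-- `α₋(ξ) = ⟨φ₋, ξ⟩_D`. -/
def αm : B.Dmax.domain →ₗ[ℂ] ℂ := graphInnerLeft B.Dmax B.φm

/-- The subspace `{ξ ∈ dom(D_max) | α₊(ξ) = l α₋(ξ)}`. -/
def extDomain (l : Circle) : Submodule ℂ H where
  carrier := {ξ | ∃ h : ξ ∈ B.Dmax.domain, B.αp ⟨ξ, h⟩ = (l : ℂ) * B.αm ⟨ξ, h⟩}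
  add_mem' := by
    rintro x y ⟨hx, ex⟩ ⟨hy, ey⟩
    refine ⟨add_mem hx hy, ?_⟩
    rw [show (⟨x + y, add_mem hx hy⟩ : B.Dmax.domain) = ⟨x, hx⟩ + ⟨y, hy⟩ from rfl,
      map_add, map_add, ex, ey, mul_add]
  zero_mem' := ⟨zero_mem _, by
    rw [show (⟨0, zero_mem _⟩ : B.Dmax.domain) = 0 from rfl, map_zero, map_zero, mul_zero]⟩
  smul_mem' := by
    rintro c x ⟨hx, ex⟩
    refine ⟨B.Dmax.domain.smul_mem c hx, ?_⟩
    rw [show (⟨c • x, B.Dmax.domain.smul_mem c hx⟩ : B.Dmax.domain) = c • ⟨x, hx⟩ from rfl,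
      map_smul, map_smul, ex, smul_eq_mul, smul_eq_mul]
    ring

/-- The selfadjoint extension `D_l` of `D` attached to `l ∈ S¹`: the restriction of `D_max` to
`{ξ ∈ dom(D_max) | α₊(ξ) = l α₋(ξ)}`. -/
def ext (l : Circle) : H →ₗ.[ℂ] H := B.Dmax.domRestrict (B.extDomain l)

/-- `η_l^⊥ = (φ₊ - conj(l) φ₋) / √2`. -/
def etaPerp (l : Circle) : B.Dmax.domain :=
  (((√2 : ℝ) : ℂ)⁻¹) • (B.φp - (starRingEnd ℂ (l : ℂ)) • B.φm)

end DeficiencyOne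

end HilbertSpace

/-! ### Operators in the Hilbert module `C₀(X, H)` over `C₀(X)` -/

section Module

variable {X : Type v} [TopologicalSpace X]
variable {H : Type u} [NormedAddCommGroup H] [InnerProductSpace ℂ H]

/-- The `C₀(X)`-valued inner product `⟨f, g⟩(x) = ⟨f(x), g(x)⟩` on `C₀(X, H)`. -/
def modInner (f g : C₀(X, H)) : C₀(X, ℂ) where
  toFun x := inner ℂ (f x) (g x)
  continuous_toFun := (map_continuous f).inner (map_continuous g)
  zero_at_infty' := by
    have h : Tendsto (fun x => (inner ℂ (f x) (g x) : ℂ)) (cocompact X)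
        (𝓝 (inner ℂ (0 : H) (0 : H))) := (zero_at_infty f).inner (zero_at_infty g)
    simpa using h

/-- The module action of `C₀(X)` on `C₀(X, H)` by pointwise multiplication. -/
def modSMul (a : C₀(X, ℂ)) (f : C₀(X, H)) : C₀(X, H) where
  toFun x := a x • f x
  continuous_toFun := (map_continuous a).smul (map_continuous f)
  zero_at_infty' := by
    have h : Tendsto (fun x => a x • f x) (cocompact X) (𝓝 ((0 : ℂ) • (0 : H))) :=
      (zero_at_infty a).smul (zero_at_infty f)
    simpa using h

/-- The graph of the module adjoint `T^*`: all `(y, z)` with `⟨y, T x⟩ = ⟨z, x⟩` in `C₀(X)` for all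
`x ∈ dom(T)`. For densely defined `T` this is the graph of an operator. -/
def adjointGraph (T : C₀(X, H) →ₗ.[ℂ] C₀(X, H)) : Submodule ℂ (C₀(X, H) × C₀(X, H)) where
  carrier := {p | ∀ x : T.domain, modInner p.1 (T x) = modInner p.2 x}
  add_mem' := by
    intro p q hp hq x
    ext t
    have h1 := DFunLike.congr_fun (hp x) t
    have h2 := DFunLike.congr_fun (hq x) t
    change inner ℂ (p.1 t) (T x t) = inner ℂ (p.2 t) ((x : C₀(X, H)) t) at h1
    change inner ℂ (q.1 t) (T x t) = inner ℂ (q.2 t) ((x : C₀(X, H)) t) at h2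
    change inner ℂ (p.1 t + q.1 t) (T x t) = inner ℂ (p.2 t + q.2 t) ((x : C₀(X, H)) t)
    rw [inner_add_left, inner_add_left, h1, h2]
  zero_mem' := by
    intro x
    ext t
    change inner ℂ (0 : H) (T x t) = inner ℂ (0 : H) ((x : C₀(X, H)) t)
    rw [inner_zero_left, inner_zero_left]
  smul_mem' := by
    intro c p hp x
    ext t
    have h1 := DFunLike.congr_fun (hp x) t
    change inner ℂ (p.1 t) (T x t) = inner ℂ (p.2 t) ((x : C₀(X, H)) t) at h1
    change inner ℂ (c • p.1 t) (T x t) = inner ℂ (c • p.2 t) ((x : C₀(X, H)) t)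
    rw [inner_smul_left, inner_smul_left, h1]

/-- `T` is semiregular: `dom(T)` is a dense `C₀(X)`-submodule and `T^*` is densely defined. -/
structure IsSemiregular (T : C₀(X, H) →ₗ.[ℂ] C₀(X, H)) : Prop where
  smul_mem : ∀ (a : C₀(X, ℂ)), ∀ f ∈ T.domain, modSMul a f ∈ T.domain
  dense_domain : Dense (T.domain : Set C₀(X, H))
  dense_adjoint : Dense {y : C₀(X, H) | ∃ z, (y, z) ∈ adjointGraph T}

/-- `T` is regular: closed, semiregular, and `I + T^* T` has dense range. -/
structure IsRegular (T : C₀(X, H) →ₗ.[ℂ] C₀(X, H)) : Prop where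
  closed : T.IsClosed
  semiregular : IsSemiregular T
  dense_range : Dense {y : C₀(X, H) | ∃ (x : T.domain) (z : C₀(X, H)),
    (T x, z) ∈ adjointGraph T ∧ y = (x : C₀(X, H)) + z}

/-- `T` is selfadjoint as an operator in the Hilbert module: densely defined with `T = T^*`. -/
structure IsModuleSelfAdjoint (T : C₀(X, H) →ₗ.[ℂ] C₀(X, H)) : Prop where
  dense_domain : Dense (T.domain : Set C₀(X, H))
  graph_eq : T.graph = adjointGraph T

variable [CompleteSpace H] (B : DeficiencyOne H)

/-- All pairs `(f, g)` in `C₀(X, H)` with `f(x) ∈ dom(D_max)` and `g(x) = D_max (f(x))` for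
every `x`. -/
def TmaxGraph (X : Type v) [TopologicalSpace X] : Submodule ℂ (C₀(X, H) × C₀(X, H)) where
  carrier := {p | ∀ x, (p.1 x, p.2 x) ∈ B.Dmax.graph}
  add_mem' := fun hp hq x => B.Dmax.graph.add_mem (hp x) (hq x)
  zero_mem' := fun _ => B.Dmax.graph.zero_mem
  smul_mem' := fun c _ hp x => B.Dmax.graph.smul_mem c (hp x)

/-- `T_max`: its domain is `C₀(X, dom(D_max))`, where `dom(D_max)` carries the graph norm, i.e.
it consists of the `f ∈ C₀(X, H)` with values in `dom(D_max)` for which `x ↦ D_max (f(x))` lies in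
`C₀(X, H)` again; and `(T_max f)(x) = D_max (f(x))`. -/
def Tmax (X : Type v) [TopologicalSpace X] : C₀(X, H) →ₗ.[ℂ] C₀(X, H) :=
  (TmaxGraph B X).toLinearPMap

theorem Tmax_graph : (Tmax B X).graph = TmaxGraph B X := by
  refine Submodule.toLinearPMap_graph_eq _ ?_
  rintro ⟨f, g⟩ h h0
  have hf : f = 0 := h0
  ext x
  refine LinearPMap.graph_fst_eq_zero_snd B.Dmax (h x) ?_
  simp [hf]

/-- `T_Λ`: the restriction of `T_max` to the `f ∈ dom(T_max)` with
`α₊(f(x)) = Λ(x) α₋(f(x))` for every `x ∈ X`. -/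
def TLam (Λ : X → Circle) : C₀(X, H) →ₗ.[ℂ] C₀(X, H) :=
  (Tmax B X).domRestrict
    { carrier := {f | ∀ x, f x ∈ B.extDomain (Λ x)}
      add_mem' := fun hf hg x => add_mem (hf x) (hg x)
      zero_mem' := fun _ => zero_mem _
      smul_mem' := fun c _ hf x => Submodule.smul_mem _ c (hf x) }

end Module

/-! ### Singularities of a function with values in the circle -/

section Singularities

variable {X : Type v} [TopologicalSpace X]

/-- The points in a neighborhood of which `Λ` is continuous. -/
def reg (Λ : X → Circle) : Set X :=
  {p | ∃ U : Set X, IsOpen U ∧ p ∈ U ∧ ContinuousOn Λ U}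

/-- The singular support. -/
def ssupp (Λ : X → Circle) : Set X := (reg Λ)ᶜ

/-- The points `p` in the boundary of `reg Λ` for which the restriction of `Λ` to `U ∩ reg Λ`
extends continuously to `U`, for some open neighborhood `U` of `p`. -/
def regInfty (Λ : X → Circle) : Set X :=
  {p | p ∈ frontier (reg Λ) ∧ ∃ U : Set X, IsOpen U ∧ p ∈ U ∧
    ∃ Λ' : X → Circle, ContinuousOn Λ' U ∧ ∀ q ∈ U ∩ reg Λ, Λ' q = Λ q}

/-- The points in the boundary of `ssupp Λ` that do not belong to `regInfty Λ`. -/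
def ssuppR (Λ : X → Circle) : Set X := frontier (ssupp Λ) \ regInfty Λ

end Singularities

/-! ### Localization with respect to a probability measure -/

section Localization

variable {X : Type v} [TopologicalSpace X] [MeasurableSpace X] [BorelSpace X]
variable {H : Type u} [NormedAddCommGroup H] [InnerProductSpace ℂ H]
  [TopologicalSpace.SeparableSpace H]
variable (μ : Measure X)

theorem memLp_of_zeroAtInfty [IsFiniteMeasure μ] (p : ℝ≥0∞) (f : C₀(X, H)) : MemLp f p μ := by
  have : SecondCountableTopology H := UniformSpace.secondCountable_of_separable H
  exact MemLp.of_bound (map_continuous f).aestronglyMeasurable ‖f‖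
    (Eventually.of_forall fun x => f.toBCF.norm_coe_le_norm x)

variable (H) in
/-- The natural map `C₀(X, H) → L²(X, μ; H)`. By `inner_toL2` and `denseRange_toL2` it exhibits
`L²(X, μ; H)` as the Hilbert space completion of `C₀(X, H)` with respect to the (possibly
degenerate) scalar product `μ(⟨f, g⟩)`, i.e. as the localization of the Hilbert module `C₀(X, H)`
with respect to the state `μ`. -/
def toL2 [IsFiniteMeasure μ] : C₀(X, H) →ₗ[ℂ] Lp H 2 μ where
  toFun f := (memLp_of_zeroAtInfty μ 2 f).toLp f
  map_add' _ _ := rfl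
  map_smul' _ _ := rfl

theorem inner_toL2 [IsFiniteMeasure μ] (f g : C₀(X, H)) :
    inner ℂ (toL2 H μ f) (toL2 H μ g) = ∫ x, modInner f g x ∂μ := by
  rw [L2.inner_def]
  refine integral_congr_ae ?_
  filter_upwards [(memLp_of_zeroAtInfty μ 2 f).coeFn_toLp,
    (memLp_of_zeroAtInfty μ 2 g).coeFn_toLp] with x hf hg
  change inner ℂ ((toL2 H μ f : X → H) x) ((toL2 H μ g : X → H) x) = inner ℂ (f x) (g x)
  rw [← hf, ← hg]; rfl

theorem exists_compactSupport_eLpNorm_sub_le [T2Space X] [LocallyCompactSpace X]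
    [IsFiniteMeasure μ] [μ.Regular] {E : Type u} [NormedAddCommGroup E] [NormedSpace ℝ E]
    {f : X → E} (hf : MemLp f 2 μ) {ε : ℝ≥0∞} (hε : ε ≠ 0) :
    ∃ g : X → E, eLpNorm (f - g) 2 μ ≤ ε ∧ Continuous g ∧ HasCompactSupport g ∧
      AEStronglyMeasurable g μ := by
  refine hf.induction_dense (by simp) _ ?_ ?_ ?_ hε
  · intro c t ht htμ ε hε
    obtain ⟨η, ηpos, hη⟩ := exists_eLpNorm_indicator_le (μ := μ) (p := 2) (by simp) c hε
    have hη2 : (η / 2 : ℝ≥0∞) ≠ 0 := by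
      simpa using ηpos.ne'
    obtain ⟨K, hKt, hK, -, hμK⟩ := ht.exists_isCompact_isClosed_sdiff_lt htμ.ne hη2
    obtain ⟨V, htV, hV, -, hμV⟩ := ht.exists_isOpen_sdiff_lt htμ.ne hη2
    obtain ⟨φ, hφK, hφV, hφc, hφ⟩ := exists_continuous_one_zero_of_isCompact hK hV.isClosed_compl
      (Set.disjoint_compl_right_iff_subset.mpr (hKt.trans htV))
    have hgc : Continuous fun x => φ x • c := φ.continuous.smul continuous_const
    have hgs : HasCompactSupport fun x => φ x • c := hφc.smul_right
    refine ⟨fun x => φ x • c, ?_, hgc, hgs, ?_⟩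
    · have hm : μ (V \ K) ≤ η := by
        have hsub : V \ K ⊆ (t \ K) ∪ (V \ t) := by
          intro x hx
          by_cases h : x ∈ t
          · exact Or.inl ⟨h, hx.2⟩
          · exact Or.inr ⟨hx.1, h⟩
        calc μ (V \ K) ≤ μ (t \ K) + μ (V \ t) := (measure_mono hsub).trans (measure_union_le _ _)
          _ ≤ η / 2 + η / 2 := add_le_add hμK.le hμV.le
          _ = η := ENNReal.add_halves _
      refine le_trans (eLpNorm_mono fun x => ?_) (hη _ hm)
      have h01 := hφ x
      by_cases hxV : x ∈ V
      · by_cases hxK : x ∈ K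
        · have h1 : φ x = 1 := hφK hxK
          simp [h1, hKt hxK]
        · have hx : x ∈ V \ K := ⟨hxV, hxK⟩
          rw [Set.indicator_of_mem hx]
          by_cases hxt : x ∈ t
          · rw [Pi.sub_apply, Set.indicator_of_mem hxt,
              show φ x • c - c = (φ x - 1) • c by rw [sub_smul, one_smul], norm_smul]
            refine mul_le_of_le_one_left (norm_nonneg _) ?_
            rw [Real.norm_eq_abs, abs_le]
            constructor <;> linarith [h01.1, h01.2]
          · rw [Pi.sub_apply, Set.indicator_of_notMem hxt, sub_zero, norm_smul]
            refine mul_le_of_le_one_left (norm_nonneg _) ?_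
            rw [Real.norm_eq_abs, abs_le]
            constructor <;> linarith [h01.1, h01.2]
      · have h0 : φ x = 0 := hφV hxV
        have hxt : x ∉ t := fun h => hxV (htV h)
        simp [h0, hxt]
    · exact (hgc.stronglyMeasurable_of_hasCompactSupport hgs).aestronglyMeasurable
  · rintro f g ⟨f1, f2, f3⟩ ⟨g1, g2, g3⟩
    exact ⟨f1.add g1, f2.add g2, f3.add g3⟩
  · rintro f ⟨-, -, h⟩
    exact h

theorem denseRange_toL2 [T2Space X] [LocallyCompactSpace X] [IsFiniteMeasure μ] [μ.Regular] :
    DenseRange (toL2 H μ) := by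
  intro u
  rw [Metric.mem_closure_range_iff]
  intro ε hε
  let _ : NormedSpace ℝ H := NormedSpace.restrictScalars ℝ ℂ H
  obtain ⟨g, hgε, hg, hgc, -⟩ := exists_compactSupport_eLpNorm_sub_le μ (Lp.memLp u)
    (ε := ENNReal.ofReal (ε / 2)) (by simpa using hε)
  let f : C₀(X, H) := ⟨⟨g, hg⟩, hgc.is_zero_at_infty⟩
  refine ⟨f, ?_⟩
  have hu : u = (Lp.memLp u).toLp u := (Lp.toLp_coeFn u _).symm
  have hd : dist u (toL2 H μ f) ≤ ε / 2 := by
    rw [hu, Lp.dist_def]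
    refine ENNReal.toReal_le_of_le_ofReal (by positivity) (le_trans (le_of_eq ?_) hgε)
    refine eLpNorm_congr_ae ?_
    filter_upwards [(memLp_of_zeroAtInfty μ 2 f).coeFn_toLp, (Lp.memLp u).coeFn_toLp]
      with x h1 h2
    change ((Lp.memLp u).toLp u : X → H) x - ((memLp_of_zeroAtInfty μ 2 f).toLp f : X → H) x = _
    rw [h1, h2]; rfl
  linarith

/-- The operator `T_0^μ` in `L²(X, μ; H)`, with domain the image of `dom(T)`, given by
`[f] ↦ [T f]`. -/
def localize₀ [IsFiniteMeasure μ] (T : C₀(X, H) →ₗ.[ℂ] C₀(X, H)) : Lp H 2 μ →ₗ.[ℂ] Lp H 2 μ :=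
  (T.graph.map ((toL2 H μ).prodMap (toL2 H μ))).toLinearPMap

/-- The localization `T^μ` of `T`: the closure of `T_0^μ`. -/
def localize [IsFiniteMeasure μ] (T : C₀(X, H) →ₗ.[ℂ] C₀(X, H)) : Lp H 2 μ →ₗ.[ℂ] Lp H 2 μ :=
  (localize₀ μ T).closure

/-- For an operator `S` in `L²(X, μ; H)` and `f, g ∈ dom(S)`, the graph inner product with values in
functions on `X`: `x ↦ ⟨f(x), g(x)⟩ + ⟨(S f)(x), (S g)(x)⟩`. -/
def fiberGraphInner {μ : Measure X} (S : Lp H 2 μ →ₗ.[ℂ] Lp H 2 μ) (f g : S.domain) (x : X) : ℂ :=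
  inner ℂ ((f : Lp H 2 μ) x) ((g : Lp H 2 μ) x) + inner ℂ (S f x) (S g x)

end Localization

/-! ### The representation by multiplication operators -/

section Representation

variable {X : Type v} [TopologicalSpace X] [MeasurableSpace X] [BorelSpace X]
variable (K : Type u) [NormedAddCommGroup K] [InnerProductSpace ℂ K] [CompleteSpace K]
variable (μ : Measure X) [IsFiniteMeasure μ]

/-- Multiplication by `a ∈ C₀(X)` on `L²(X, μ; K)`. -/
def mulOp (a : C₀(X, ℂ)) : Lp K 2 μ →L[ℂ] Lp K 2 μ :=
  (ContinuousLinearMap.lsmul ℂ ℂ : ℂ →L[ℂ] K →L[ℂ] K).holderL μ ∞ 2 2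
    ((memLp_of_zeroAtInfty μ ∞ a).toLp a)

theorem mulOp_coeFn (a : C₀(X, ℂ)) (u : Lp K 2 μ) :
    (mulOp K μ a u : X → K) =ᵐ[μ] fun x => a x • u x := by
  have h := ContinuousLinearMap.coeFn_holder (r := 2) (μ := μ)
    (ContinuousLinearMap.lsmul ℂ ℂ : ℂ →L[ℂ] K →L[ℂ] K)
    ((memLp_of_zeroAtInfty μ ∞ a).toLp a) u
  filter_upwards [h, (memLp_of_zeroAtInfty μ ∞ a).coeFn_toLp] with x hx ha
  rw [ha] at hx
  exact hx

/-- The representation `π_μ` of `C₀(X)` on `L²(X, μ; K)` by multiplication operators. For `K = ℂ`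
this is the cyclic representation attached to the state `μ`. -/
def mulRep : C₀(X, ℂ) →⋆ₙₐ[ℂ] (Lp K 2 μ →L[ℂ] Lp K 2 μ) where
  toFun := mulOp K μ
  map_smul' c a := by
    ext1 u
    refine Lp.ext ?_
    filter_upwards [mulOp_coeFn K μ (c • a) u, mulOp_coeFn K μ a u,
      Lp.coeFn_smul c (mulOp K μ a u)] with x h1 h2 h3
    change (mulOp K μ (c • a) u : X → K) x = (c • mulOp K μ a u : Lp K 2 μ) x
    rw [h1, h3, Pi.smul_apply, h2, ← smul_assoc]; rfl
  map_zero' := by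
    ext1 u
    refine Lp.ext ?_
    filter_upwards [mulOp_coeFn K μ 0 u, Lp.coeFn_zero K 2 μ] with x h1 h2
    change (mulOp K μ 0 u : X → K) x = (0 : Lp K 2 μ) x
    rw [h1, h2]; exact zero_smul ℂ _
  map_add' a b := by
    ext1 u
    refine Lp.ext ?_
    filter_upwards [mulOp_coeFn K μ (a + b) u, mulOp_coeFn K μ a u, mulOp_coeFn K μ b u,
      Lp.coeFn_add (mulOp K μ a u) (mulOp K μ b u)] with x h1 h2 h3 h4
    change (mulOp K μ (a + b) u : X → K) x = (mulOp K μ a u + mulOp K μ b u : Lp K 2 μ) x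
    rw [h1, h4, Pi.add_apply, h2, h3, ← add_smul]; rfl
  map_mul' a b := by
    ext1 u
    refine Lp.ext ?_
    filter_upwards [mulOp_coeFn K μ (a * b) u, mulOp_coeFn K μ a (mulOp K μ b u),
      mulOp_coeFn K μ b u] with x h1 h2 h3
    change (mulOp K μ (a * b) u : X → K) x = (mulOp K μ a (mulOp K μ b u) : Lp K 2 μ) x
    rw [h1, h2, h3, smul_smul]; rfl
  map_star' a := by
    rw [ContinuousLinearMap.star_eq_adjoint, ContinuousLinearMap.eq_adjoint_iff]
    intro u v
    rw [L2.inner_def, L2.inner_def]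
    refine integral_congr_ae ?_
    filter_upwards [mulOp_coeFn K μ (star a) u, mulOp_coeFn K μ a v] with x h1 h2
    rw [h1, h2, inner_smul_left, inner_smul_right]
    change starRingEnd ℂ (star (a x)) * _ = _
    simp

end Representation

end ModuleLocalization

end

/-! Everything is decided fibrewise, on graphs viewed as closed subspaces of the Hilbert sum of two
copies of `H`. Von Neumann's decomposition writes the graph of `D^*` as the orthogonal sum of the
graph of `D` and the two lines through `vp` and `vm`. The graph of `D_l` is the hyperplane α₊ = l α₋
in it, with unit normal `etaVec l`. Green's formula (`boundary_form`) makes `D_l` selfadjoint, and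
the projection `extProj l` onto its graph is norm continuous in `l`.

The graph of `T_Λ` consists of the C₀ sections of the field x ↦ graph of `D_{Λ(x)}`. This field is
continuous over the open set `reg Λ`, which has full measure, so cutting off and projecting L²
approximations shows that the localized graph consists of all square integrable sections
(`mem_graph_localize_iff`). Thus `μ` does not see the singularities: selfadjointness of the
localization and both descriptions of its domain reduce to statements in almost every fibre.

The module does see them. A pair in the adjoint graph satisfies the boundary condition on `reg Λ`,
which is dense, and inherits by continuity whatever survives in the limit. At a point of `ssuppR Λ`
both α₊ and α₋ must vanish, since otherwise α₊/α₋ would extend Λ continuously; hence `T_Λ` is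
selfadjoint when the whole frontier is of this kind. Near a removable singularity, some point q has
Λ'(q) ≠ Λ(q) for the extension Λ'. Elements of the domain satisfy both conditions at q, those of the
adjoint only the one for Λ', so `T_Λ` is not selfadjoint. In either case a fixed nonzero vector is
orthogonal at one point to all values of `I + T^*T`, which excludes regularity.

For the example, let R be multiplication by the coordinate on L²[0,1] and w a vector outside its
range. The restriction of R⁻¹ to the image of the complement of w has deficiency indices (1,1). A
jump and a removable discontinuity at 1/2 realize the two cases. -/

noncomputable section

namespace ModuleLocalization

/-! ### Selfadjoint extensions in one fibre: von Neumann decomposition and boundary form -/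

section Fibre

variable {H : Type u} [NormedAddCommGroup H] [InnerProductSpace ℂ H]

/-- The graph of `T`, as a subspace of the Hilbert sum of two copies of `H`. -/
def l2Graph (T : H →ₗ.[ℂ] H) : Submodule ℂ (WithLp 2 (H × H)) :=
  T.graph.comap (WithLp.linearEquiv 2 ℂ (H × H)).toLinearMap

theorem mem_l2Graph {T : H →ₗ.[ℂ] H} {p : WithLp 2 (H × H)} :
    p ∈ l2Graph T ↔ (p.fst, p.snd) ∈ T.graph := Iff.rfl

theorem l2_inner (p q : WithLp 2 (H × H)) :
    inner ℂ p q = inner ℂ p.fst q.fst + inner ℂ p.snd q.snd := rfl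

theorem isClosed_l2Graph {T : H →ₗ.[ℂ] H} (hT : T.IsClosed) :
    IsClosed (l2Graph T : Set (WithLp 2 (H × H))) :=
  IsClosed.preimage (WithLp.prod_continuous_ofLp 2 H H) hT

/-- The graph vector `(ξ, T ξ)`. -/
def graphVec (T : H →ₗ.[ℂ] H) (ξ : T.domain) : WithLp 2 (H × H) := WithLp.toLp 2 ((ξ : H), T ξ)

theorem graphVec_mem (T : H →ₗ.[ℂ] H) (ξ : T.domain) : graphVec T ξ ∈ l2Graph T := T.mem_graph ξ

theorem mem_graph_adjoint_iff [CompleteSpace H] {T : H →ₗ.[ℂ] H} (hT : Dense (T.domain : Set H))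
    {y z : H} : (y, z) ∈ T.adjoint.graph ↔
      ∀ a b, (a, b) ∈ T.graph → inner ℂ y b = inner ℂ z a := by
  rw [LinearPMap.adjoint_graph_eq_graph_adjoint hT, Submodule.mem_adjoint_iff]
  refine forall₃_congr fun a b _ => ?_
  rw [sub_eq_zero]
  constructor
  · intro h
    rw [← inner_conj_symm, h, inner_conj_symm]
  · intro h
    rw [← inner_conj_symm, h, inner_conj_symm]

namespace DeficiencyOne

variable [CompleteSpace H] (B : DeficiencyOne H)

/-- `(φ₊, i φ₊)`. -/
def vp : WithLp 2 (H × H) := WithLp.toLp 2 ((B.φp : H), Complex.I • (B.φp : H))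

/-- `(φ₋, -i φ₋)`. -/
def vm : WithLp 2 (H × H) := WithLp.toLp 2 ((B.φm : H), -Complex.I • (B.φm : H))

theorem vp_mem : B.vp ∈ l2Graph B.Dmax := by
  have h : ((B.φp : H), B.D.adjoint B.φp) ∈ B.D.adjoint.graph := LinearPMap.mem_graph _ _
  rw [B.apply_φp] at h
  exact h

theorem vm_mem : B.vm ∈ l2Graph B.Dmax := by
  have h : ((B.φm : H), B.D.adjoint B.φm) ∈ B.D.adjoint.graph := LinearPMap.mem_graph _ _
  rw [B.apply_φm] at h
  exact h

theorem αp_eq (ξ : B.Dmax.domain) : B.αp ξ = inner ℂ B.vp (graphVec B.Dmax ξ) := by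
  rw [l2_inner]
  change inner ℂ (B.φp : H) (ξ : H) + inner ℂ (B.D.adjoint B.φp) _ = _
  rw [B.apply_φp]; rfl

theorem αm_eq (ξ : B.Dmax.domain) : B.αm ξ = inner ℂ B.vm (graphVec B.Dmax ξ) := by
  rw [l2_inner]
  change inner ℂ (B.φm : H) (ξ : H) + inner ℂ (B.D.adjoint B.φm) _ = _
  rw [B.apply_φm]; rfl

theorem inner_vp (p : WithLp 2 (H × H)) : inner ℂ B.vp p =
    inner ℂ (B.φp : H) p.fst - Complex.I * inner ℂ (B.φp : H) p.snd := by
  rw [l2_inner]; simp [vp]; ring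

theorem inner_vm (p : WithLp 2 (H × H)) : inner ℂ B.vm p =
    inner ℂ (B.φm : H) p.fst + Complex.I * inner ℂ (B.φm : H) p.snd := by
  rw [l2_inner]; simp [vm, inner_smul_left]

theorem inner_vp_vp : inner ℂ B.vp B.vp = 1 := by
  have h := B.norm_φp
  rw [graphInner, B.apply_φp] at h
  exact h

theorem inner_vm_vm : inner ℂ B.vm B.vm = 1 := by
  have h := B.norm_φm
  rw [graphInner, B.apply_φm] at h
  exact h

/-- The second components contribute conj(i)·(-i) = -1 times the first contribution, so the graph
product cancels even if φ₊ and φ₋ are not orthogonal in `H`. -/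
theorem inner_vp_vm : inner ℂ B.vp B.vm = 0 := by
  rw [inner_vp]
  simp only [vm, WithLp.toLp_fst, WithLp.toLp_snd, inner_smul_right]
  linear_combination inner ℂ (B.φp : H) (B.φm : H) * Complex.I_mul_I

theorem inner_vm_vp : inner ℂ B.vm B.vp = 0 := by
  rw [← inner_conj_symm, inner_vp_vm, map_zero]

theorem φp_ne_zero : (B.φp : H) ≠ 0 := by
  intro h
  have h1 := B.inner_vp_vp
  rw [inner_vp, h] at h1
  simp at h1

theorem isClosed_Dmax : B.Dmax.IsClosed := LinearPMap.adjoint_isClosed B.dense_domain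

theorem D_graph_le : l2Graph B.D ≤ l2Graph B.Dmax := fun _ hp =>
  LinearPMap.le_graph_of_le B.symmetric hp

theorem mem_Dmax_iff {p : WithLp 2 (H × H)} : p ∈ l2Graph B.Dmax ↔
    ∀ q ∈ l2Graph B.D, inner ℂ p.fst q.snd = inner ℂ p.snd q.fst := by
  rw [mem_l2Graph, Dmax, mem_graph_adjoint_iff B.dense_domain]
  exact ⟨fun h q hq => h _ _ hq, fun h a b hab => h (WithLp.toLp 2 (a, b)) hab⟩

/-- Pairing the eigenvector of `D^*` with `D` turns the second term of the graph product into minus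
the first. -/
theorem inner_vp_of_mem_D {p : WithLp 2 (H × H)} (hp : p ∈ l2Graph B.D) :
    inner ℂ B.vp p = 0 := by
  have h := (B.mem_Dmax_iff.1 B.vp_mem) p hp
  simp only [vp, WithLp.toLp_fst, WithLp.toLp_snd, inner_smul_left, Complex.conj_I] at h
  rw [inner_vp, h]
  linear_combination inner ℂ (B.φp : H) p.fst * Complex.I_mul_I

theorem inner_vm_of_mem_D {p : WithLp 2 (H × H)} (hp : p ∈ l2Graph B.D) :
    inner ℂ B.vm p = 0 := by
  have h := (B.mem_Dmax_iff.1 B.vm_mem) p hp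
  simp only [vm, WithLp.toLp_fst, WithLp.toLp_snd, inner_smul_left, map_neg, Complex.conj_I,
    neg_neg] at h
  rw [inner_vm, h]
  linear_combination inner ℂ (B.φm : H) p.fst * Complex.I_mul_I

theorem exists_smul_of_finrank_one {E : Type*} [AddCommGroup E] [Module ℂ E]
    {S : Submodule ℂ E} (hS : Module.finrank ℂ S = 1) {v w : E} (hv : v ∈ S) (hv0 : v ≠ 0)
    (hw : w ∈ S) : ∃ c : ℂ, c • v = w := by
  obtain ⟨c, hc⟩ := (finrank_eq_one_iff_of_nonzero' (⟨v, hv⟩ : S)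
    (fun h => hv0 (congrArg Subtype.val h))).1 hS ⟨w, hw⟩
  exact ⟨c, congrArg Subtype.val hc⟩

theorem φm_ne_zero : (B.φm : H) ≠ 0 := by
  intro h
  have h1 := B.inner_vm_vm
  rw [inner_vm, h] at h1
  simp at h1

/-- The von Neumann decomposition: a vector in the graph of `D^*` that is orthogonal to
the deficiency spaces lies in the graph of `D`. -/
theorem mem_D_of_inner_eq_zero {p : WithLp 2 (H × H)} (hp : p ∈ l2Graph B.Dmax)
    (hpl : inner ℂ B.vp p = 0) (hmi : inner ℂ B.vm p = 0) : p ∈ l2Graph B.D := by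
  have hcl : IsClosed (l2Graph B.D : Set (WithLp 2 (H × H))) := isClosed_l2Graph B.closed
  have : CompleteSpace (l2Graph B.D) := hcl.completeSpace_coe
  obtain ⟨a, ha, r, hr, rfl⟩ := (l2Graph B.D).exists_add_mem_mem_orthogonal p
  have hrm : r ∈ l2Graph B.Dmax := by
    have := (l2Graph B.Dmax).sub_mem hp (B.D_graph_le ha)
    simpa using this
  -- Orthogonality of r to the graph of `D` says exactly that `D^*` sends `r.snd` to `-r.fst`. Hence
  -- (D^*)² = -1 on `r.fst`, and (D^* ± i) `r.fst` are eigenvectors for ±i.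
  have hr' : (WithLp.toLp 2 (r.snd, -r.fst)) ∈ l2Graph B.Dmax := by
    rw [mem_Dmax_iff]
    intro q hq
    have h := (Submodule.mem_orthogonal' _ _).1 hr q hq
    rw [l2_inner] at h
    change inner ℂ r.snd q.snd = inner ℂ (-r.fst) q.fst
    rw [inner_neg_left]
    linear_combination h
  have epl : r.snd + Complex.I • r.fst ∈ eigenspace B.D.adjoint Complex.I := by
    have h := (l2Graph B.Dmax).add_mem hr' ((l2Graph B.Dmax).smul_mem Complex.I hrm)
    have e : -r.fst + Complex.I • r.snd = Complex.I • (r.snd + Complex.I • r.fst) := by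
      rw [smul_add, smul_smul, Complex.I_mul_I]; module
    change (r.snd + Complex.I • r.fst, -r.fst + Complex.I • r.snd) ∈ B.D.adjoint.graph at h
    rw [e] at h
    exact h
  have emi : r.snd - Complex.I • r.fst ∈ eigenspace B.D.adjoint (-Complex.I) := by
    have h := (l2Graph B.Dmax).sub_mem hr' ((l2Graph B.Dmax).smul_mem Complex.I hrm)
    have e : -r.fst - Complex.I • r.snd = (-Complex.I) • (r.snd - Complex.I • r.fst) := by
      rw [smul_sub, smul_smul, neg_mul, Complex.I_mul_I]; module
    change (r.snd - Complex.I • r.fst, -r.fst - Complex.I • r.snd) ∈ B.D.adjoint.graph at h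
    rw [e] at h
    exact h
  obtain ⟨c, hc⟩ := exists_smul_of_finrank_one B.deficiency_plus (v := (B.φp : H)) B.vp_mem
    B.φp_ne_zero epl
  obtain ⟨d, hd⟩ := exists_smul_of_finrank_one B.deficiency_minus (v := (B.φm : H)) B.vm_mem
    B.φm_ne_zero emi
  have hIfst : (2 * Complex.I) • r.fst = c • (B.φp : H) - d • (B.φm : H) := by
    rw [hc, hd]; module
  have hsnd : (2 : ℂ) • r.snd = c • (B.φp : H) + d • (B.φm : H) := by
    rw [hc, hd]; module
  have hI : (2 * Complex.I) ≠ 0 := by simp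
  have hr2 : (2 * Complex.I) • r = c • B.vp - d • B.vm := by
    refine WithLp.ofLp_injective 2 (Prod.ext hIfst ?_)
    change (2 * Complex.I) • r.snd = c • Complex.I • (B.φp : H) - d • -Complex.I • (B.φm : H)
    rw [mul_comm, mul_smul, hsnd]; module
  rw [inner_add_right, B.inner_vp_of_mem_D ha, zero_add] at hpl
  rw [inner_add_right, B.inner_vm_of_mem_D ha, zero_add] at hmi
  have hc0 : c = 0 := by
    have := congrArg (inner ℂ B.vp) hr2
    rw [inner_sub_right, inner_smul_right, inner_smul_right, inner_smul_right, hpl, inner_vp_vp,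
      inner_vp_vm] at this
    linear_combination -this
  have hd0 : d = 0 := by
    have := congrArg (inner ℂ B.vm) hr2
    rw [inner_sub_right, inner_smul_right, inner_smul_right, inner_smul_right, hmi, inner_vm_vp,
      inner_vm_vm] at this
    linear_combination this
  have hr0 : r = 0 := by
    rw [hc0, hd0] at hr2
    simpa using hr2
  rw [hr0, add_zero]
  exact ha

/-- The graph of `D_l`, as a subspace of the Hilbert sum. -/
def extGraph (l : Circle) : Submodule ℂ (WithLp 2 (H × H)) := l2Graph (B.ext l)

theorem mem_extGraph {l : Circle} {p : WithLp 2 (H × H)} : p ∈ B.extGraph l ↔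
    p ∈ l2Graph B.Dmax ∧ inner ℂ B.vp p = l * inner ℂ B.vm p := by
  have key : ∀ h : p.fst ∈ B.Dmax.domain, B.Dmax ⟨p.fst, h⟩ = p.snd →
      graphVec B.Dmax ⟨p.fst, h⟩ = p := by
    intro h e
    rw [graphVec, e]; rfl
  constructor
  · intro h
    obtain ⟨ξ, h1, h2⟩ := (LinearPMap.mem_graph_iff _).1 (mem_l2Graph.1 h)
    obtain ⟨⟨hm, hξ⟩, hm'⟩ := ξ.2
    dsimp only at h1 h2
    have hfst : p.fst ∈ B.Dmax.domain := h1 ▸ hm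
    have hD : B.Dmax ⟨p.fst, hfst⟩ = p.snd := by
      rw [← h2]
      exact (LinearPMap.domRestrict_apply (f := B.Dmax) (x := ξ) (y := ⟨p.fst, hfst⟩) h1).symm
    refine ⟨mem_l2Graph.2 ((LinearPMap.mem_graph_iff _).2 ⟨⟨p.fst, hfst⟩, rfl, hD⟩), ?_⟩
    have hξ' : B.αp ⟨p.fst, hfst⟩ = (l : ℂ) * B.αm ⟨p.fst, hfst⟩ := by
      convert hξ using 3 <;> simp [h1]
    rwa [αp_eq, αm_eq, key hfst hD] at hξ'
  · rintro ⟨h, he⟩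
    obtain ⟨ξ, h1, h2⟩ := (LinearPMap.mem_graph_iff _).1 (mem_l2Graph.1 h)
    dsimp only at h1 h2
    have hfst : p.fst ∈ B.Dmax.domain := h1 ▸ ξ.2
    have hD : B.Dmax ⟨p.fst, hfst⟩ = p.snd := by
      rw [← h2]; congr 1; exact Subtype.ext h1.symm
    have hm : p.fst ∈ B.extDomain l := by
      refine ⟨hfst, ?_⟩
      rw [αp_eq, αm_eq, key hfst hD, he]
    refine mem_l2Graph.2 ((LinearPMap.mem_graph_iff _).2 ⟨⟨p.fst, ⟨hm, hfst⟩⟩, rfl, ?_⟩)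
    rw [← hD]
    exact LinearPMap.domRestrict_apply (f := B.Dmax) rfl

theorem extGraph_le (l : Circle) : B.extGraph l ≤ l2Graph B.Dmax :=
  fun _ h => (B.mem_extGraph.1 h).1

theorem D_le_extGraph (l : Circle) : l2Graph B.D ≤ B.extGraph l := fun p hp =>
  B.mem_extGraph.2 ⟨B.D_graph_le hp, by
    rw [B.inner_vp_of_mem_D hp, B.inner_vm_of_mem_D hp, mul_zero]⟩

theorem isClosed_extGraph (l : Circle) : IsClosed (B.extGraph l : Set (WithLp 2 (H × H))) := by
  have : (B.extGraph l : Set (WithLp 2 (H × H))) =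
      (l2Graph B.Dmax : Set (WithLp 2 (H × H))) ∩ {p | inner ℂ B.vp p = l * inner ℂ B.vm p} := by
    ext p; exact B.mem_extGraph
  rw [this]
  exact (isClosed_l2Graph B.isClosed_Dmax).inter
    (isClosed_eq (continuous_const.inner continuous_id)
      (continuous_const.mul (continuous_const.inner continuous_id)))

/-- The boundary vector `l φ₊ + φ₋` spanning the graph of `D_l` modulo that of `D`. -/
def bdryVec (l : Circle) : WithLp 2 (H × H) := (l : ℂ) • B.vp + B.vm

theorem inner_vp_bdryVec (l : Circle) : inner ℂ B.vp (B.bdryVec l) = l := by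
  rw [bdryVec, inner_add_right, inner_smul_right, inner_vp_vp, inner_vp_vm, mul_one, add_zero]

theorem inner_vm_bdryVec (l : Circle) : inner ℂ B.vm (B.bdryVec l) = 1 := by
  rw [bdryVec, inner_add_right, inner_smul_right, inner_vm_vp, inner_vm_vm, mul_zero, zero_add]

theorem bdryVec_mem (l : Circle) : B.bdryVec l ∈ B.extGraph l :=
  B.mem_extGraph.2 ⟨add_mem ((l2Graph B.Dmax).smul_mem _ B.vp_mem) B.vm_mem, by
    rw [inner_vp_bdryVec, inner_vm_bdryVec, mul_one]⟩

/-- Green's formula against the boundary vector: for |l| = 1 the right side vanishes exactly when α₊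
= l α₋. -/
theorem boundary_form (p : WithLp 2 (H × H)) (l : Circle) :
    inner ℂ p.fst (B.bdryVec l).snd - inner ℂ p.snd (B.bdryVec l).fst =
      Complex.I * (l * starRingEnd ℂ (inner ℂ B.vp p) - starRingEnd ℂ (inner ℂ B.vm p)) := by
  simp only [inner_vp, inner_vm, map_sub, map_add, map_mul, inner_conj_symm, Complex.conj_I]
  simp only [bdryVec, vp, vm, WithLp.add_fst, WithLp.add_snd, WithLp.smul_fst, WithLp.smul_snd,
    WithLp.toLp_fst, WithLp.toLp_snd, inner_add_right, inner_smul_right]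
  linear_combination (-(l : ℂ) * inner ℂ p.snd (B.φp : H) - inner ℂ p.snd (B.φm : H))
    * Complex.I_mul_I

theorem circle_mul_conj (l : Circle) : (l : ℂ) * starRingEnd ℂ (l : ℂ) = 1 := by
  rw [Complex.mul_conj, Circle.normSq_coe]; simp

theorem boundary_form_eq_zero_iff {p : WithLp 2 (H × H)} {l : Circle} :
    inner ℂ p.fst (B.bdryVec l).snd = inner ℂ p.snd (B.bdryVec l).fst ↔
      inner ℂ B.vp p = l * inner ℂ B.vm p := by
  rw [← sub_eq_zero, boundary_form, mul_eq_zero, or_iff_right Complex.I_ne_zero, sub_eq_zero]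
  have hl := circle_mul_conj l
  constructor
  · intro h
    have h' := congrArg (starRingEnd ℂ) h
    simp only [map_mul, Complex.conj_conj] at h'
    rw [← h', ← mul_assoc, hl, one_mul]
  · intro h
    rw [h, map_mul, ← mul_assoc, hl, one_mul]

/-- Subtracting α₋(p) times the boundary vector kills α₋, and then also α₊ by the boundary
condition; the rest lies in the graph of `D`. So symmetry of `D_l` has to be tested on one extra
vector only. -/
theorem exists_eq_add_bdryVec {l : Circle} {p : WithLp 2 (H × H)} (hp : p ∈ B.extGraph l) :
    ∃ a ∈ l2Graph B.D, p = a + inner ℂ B.vm p • B.bdryVec l := by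
  refine ⟨p - inner ℂ B.vm p • B.bdryVec l, B.mem_D_of_inner_eq_zero ?_ ?_ ?_, by simp⟩
  · exact B.extGraph_le l (sub_mem hp ((B.extGraph l).smul_mem _ (B.bdryVec_mem l)))
  · rw [inner_sub_right, inner_smul_right, inner_vp_bdryVec, (B.mem_extGraph.1 hp).2]; ring
  · rw [inner_sub_right, inner_smul_right, inner_vm_bdryVec]; ring

/-- `D_l` is selfadjoint. -/
theorem mem_extGraph_iff_forall {l : Circle} {p : WithLp 2 (H × H)} : p ∈ B.extGraph l ↔
    ∀ q ∈ B.extGraph l, inner ℂ p.fst q.snd = inner ℂ p.snd q.fst := by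
  constructor
  · intro hp q hq
    obtain ⟨a, ha, e⟩ := B.exists_eq_add_bdryVec hq
    have h1 := B.mem_Dmax_iff.1 (B.extGraph_le l hp) a ha
    have h2 := B.boundary_form_eq_zero_iff.2 (B.mem_extGraph.1 hp).2
    rw [e]
    simp only [WithLp.add_fst, WithLp.add_snd, WithLp.smul_fst, WithLp.smul_snd, inner_add_right,
      inner_smul_right, h1, h2]
  · intro h
    refine B.mem_extGraph.2 ⟨B.mem_Dmax_iff.2 fun q hq => h q (B.D_le_extGraph l hq), ?_⟩
    exact B.boundary_form_eq_zero_iff.1 (h _ (B.bdryVec_mem l))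

/-- The graph vector of `η_l^⊥`. -/
def etaVec (l : Circle) : WithLp 2 (H × H) :=
  (((√2 : ℝ) : ℂ)⁻¹) • (B.vp - (starRingEnd ℂ (l : ℂ)) • B.vm)

theorem graphVec_φp : graphVec B.Dmax B.φp = B.vp := by
  change WithLp.toLp 2 ((B.φp : H), B.D.adjoint B.φp) = _
  rw [B.apply_φp]; rfl

theorem graphVec_φm : graphVec B.Dmax B.φm = B.vm := by
  change WithLp.toLp 2 ((B.φm : H), B.D.adjoint B.φm) = _
  rw [B.apply_φm]; rfl

theorem graphVec_etaPerp (l : Circle) : graphVec B.Dmax (B.etaPerp l) = B.etaVec l := by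
  rw [etaVec, ← graphVec_φp, ← graphVec_φm]
  refine WithLp.ofLp_injective 2 (Prod.ext rfl ?_)
  change B.Dmax.toFun ((((√2 : ℝ) : ℂ)⁻¹) • (B.φp - (starRingEnd ℂ (l : ℂ)) • B.φm)) = _
  refine (map_smul B.Dmax.toFun _ _).trans (congrArg _ ?_)
  exact (map_sub B.Dmax.toFun _ _).trans (congrArg _ (map_smul B.Dmax.toFun _ _))

theorem etaVec_mem (l : Circle) : B.etaVec l ∈ l2Graph B.Dmax := by
  rw [← graphVec_etaPerp]; exact graphVec_mem _ _

theorem inner_etaVec (l : Circle) (p : WithLp 2 (H × H)) : inner ℂ (B.etaVec l) p =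
    (((√2 : ℝ) : ℂ)⁻¹) * (inner ℂ B.vp p - l * inner ℂ B.vm p) := by
  simp only [etaVec, inner_smul_left, inner_sub_left, Complex.conj_conj, map_inv₀,
    Complex.conj_ofReal]

theorem inner_etaVec_eq_zero_iff {l : Circle} {p : WithLp 2 (H × H)} :
    inner ℂ (B.etaVec l) p = 0 ↔ inner ℂ B.vp p = l * inner ℂ B.vm p := by
  rw [inner_etaVec, mul_eq_zero, or_iff_right (by simp), sub_eq_zero]

theorem inner_etaVec_self (l : Circle) : inner ℂ (B.etaVec l) (B.etaVec l) = 1 := by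
  rw [inner_etaVec]
  simp only [etaVec, inner_smul_right, inner_sub_right, inner_vp_vp, inner_vm_vm, inner_vp_vm,
    inner_vm_vp]
  have h2 : ((√2 : ℝ) : ℂ) ^ 2 = 2 := by
    rw [← Complex.ofReal_pow, Real.sq_sqrt (by norm_num)]; norm_num
  have h0 : ((√2 : ℝ) : ℂ) ≠ 0 := by simp
  field_simp
  linear_combination circle_mul_conj l - h2

theorem norm_etaVec (l : Circle) : ‖B.etaVec l‖ = 1 := by
  have h := inner_self_eq_norm_sq_to_K (𝕜 := ℂ) (B.etaVec l)
  rw [inner_etaVec_self] at h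
  have h2 : ‖B.etaVec l‖ ^ 2 = 1 := by
    rw [← Complex.ofReal_inj]; push_cast; exact h.symm
  nlinarith [norm_nonneg (B.etaVec l)]

theorem continuous_etaVec : Continuous B.etaVec := by
  unfold etaVec
  fun_prop

instance : (l2Graph B.Dmax).HasOrthogonalProjection :=
  haveI : CompleteSpace (l2Graph B.Dmax) :=
    (isClosed_l2Graph B.isClosed_Dmax).completeSpace_coe
  inferInstance

/-- The orthogonal projection onto the graph of `D_l`. -/
def extProj (l : Circle) : WithLp 2 (H × H) →L[ℂ] WithLp 2 (H × H) :=
  (l2Graph B.Dmax).starProjection - InnerProductSpace.rankOne ℂ (B.etaVec l) (B.etaVec l)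

theorem extProj_apply (l : Circle) (p : WithLp 2 (H × H)) : B.extProj l p =
    (l2Graph B.Dmax).starProjection p - inner ℂ (B.etaVec l) p • B.etaVec l := rfl

theorem inner_starProjection {p q : WithLp 2 (H × H)} (hq : q ∈ l2Graph B.Dmax) :
    inner ℂ q ((l2Graph B.Dmax).starProjection p) = inner ℂ q p := by
  rw [← Submodule.inner_starProjection_left_eq_right,
    Submodule.starProjection_eq_self_iff.2 hq]

theorem extProj_mem (l : Circle) (p : WithLp 2 (H × H)) : B.extProj l p ∈ B.extGraph l := by
  rw [mem_extGraph, ← inner_etaVec_eq_zero_iff, extProj_apply]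
  refine ⟨sub_mem (Submodule.starProjection_apply_mem _ _)
    ((l2Graph B.Dmax).smul_mem _ (B.etaVec_mem l)), ?_⟩
  rw [inner_sub_right, inner_smul_right, inner_etaVec_self, B.inner_starProjection (B.etaVec_mem l)]
  ring

theorem extProj_eq_self {l : Circle} {p : WithLp 2 (H × H)} (hp : p ∈ B.extGraph l) :
    B.extProj l p = p := by
  rw [extProj_apply, Submodule.starProjection_eq_self_iff.2 (B.extGraph_le l hp),
    B.inner_etaVec_eq_zero_iff.2 (B.mem_extGraph.1 hp).2, zero_smul, sub_zero]

/-- Only the rank one part depends on `l`. Through this lemma, continuity of Λ becomes continuity of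
the field of graphs. -/
theorem continuous_extProj : Continuous B.extProj := by
  have h := B.continuous_etaVec
  refine continuous_const.sub ?_
  have h1 : Continuous fun l => innerSL ℂ (B.etaVec l) := (innerSL ℂ).continuous.comp h
  exact ((ContinuousLinearMap.smulRightL ℂ (WithLp 2 (H × H))
    (WithLp 2 (H × H))).continuous.comp h1).clm_apply h

/-- The triangle inequality gives 2 in place of the sharp bound 1; uniformity in `l` is all that is
needed. -/
theorem norm_extProj_le (l : Circle) : ‖B.extProj l‖ ≤ 2 := by
  refine (norm_sub_le _ _).trans ?_
  rw [InnerProductSpace.norm_rankOne, norm_etaVec]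
  linarith [(l2Graph B.Dmax).starProjection_norm_le]

end DeficiencyOne

end Fibre

/-! ### Cutoffs and approximation in C₀(X, E) -/

section ZeroAtInfinity

variable {X : Type*} [TopologicalSpace X]
variable {E F : Type*} [NormedAddCommGroup E] [NormedSpace ℂ E]
  [NormedAddCommGroup F] [NormedSpace ℂ F]

/-- Composition of a function vanishing at infinity with a continuous linear map. -/
def mapC0 (L : E →L[ℂ] F) (f : C₀(X, E)) : C₀(X, F) where
  toFun x := L (f x)
  continuous_toFun := L.continuous.comp (map_continuous f)
  zero_at_infty' := by
    have h := (L.continuous.tendsto 0).comp (zero_at_infty f)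
    rwa [map_zero] at h

omit [NormedSpace ℂ E] in
theorem norm_C0_le {f : C₀(X, E)} {C : ℝ} (hC : 0 ≤ C) (h : ∀ x, ‖f x‖ ≤ C) : ‖f‖ ≤ C :=
  (BoundedContinuousFunction.norm_le (f := f.toBCF) hC).2 h

omit [NormedSpace ℂ E] in
theorem continuous_C0_eval (x : X) : Continuous fun f : C₀(X, E) => f x :=
  (BoundedContinuousFunction.lipschitz_eval_const x).continuous.comp
    ZeroAtInftyContinuousMap.isometry_toBCF.continuous

/-- A cutoff function which turns sections defined and continuous on an open set `O` into
elements of `C₀(X, E)`. -/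
theorem exists_cutoff [T2Space X] [LocallyCompactSpace X] {O K : Set X} (hO : IsOpen O)
    (hK : IsCompact K) (hKO : K ⊆ O) : ∃ χ : X → ℂ, Continuous χ ∧ (∀ x, ‖χ x‖ ≤ 1) ∧
      (∀ x, ‖1 - χ x‖ ≤ 1) ∧ (∀ x ∈ K, χ x = 1) ∧ HasCompactSupport χ ∧ tsupport χ ⊆ O := by
  obtain ⟨L, hL, hLc, hKL, hLO⟩ := exists_compact_closed_between hK hO hKO
  obtain ⟨χ, h1, h0, hc, h01⟩ := exists_continuous_one_zero_of_isCompact hK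
    isOpen_interior.isClosed_compl (Set.disjoint_compl_right_iff_subset.2 hKL)
  refine ⟨fun x => (χ x : ℂ), by fun_prop, fun x => ?_, fun x => ?_, fun x hx => ?_, ?_, ?_⟩
  · rw [Complex.norm_real, Real.norm_of_nonneg (h01 x).1]
    exact (h01 x).2
  · rw [← Complex.ofReal_one, ← Complex.ofReal_sub, Complex.norm_real,
      Real.norm_of_nonneg (sub_nonneg.2 (h01 x).2)]
    linarith [(h01 x).1]
  · have := h1 hx
    simpa using this
  · exact hc.comp_left (g := fun r : ℝ => (r : ℂ)) Complex.ofReal_zero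
  · refine (closure_minimal (fun x hx => ?_) hLc).trans hLO
    by_contra hxL
    have : χ x = 0 := h0 fun h => hxL (interior_subset h)
    exact hx (by simp [this])

/-- The product of a cutoff function and a section. -/
theorem exists_C0_smul {O : Set X} (hO : IsOpen O) {χ : X → ℂ} (hχ : Continuous χ)
    (hχc : HasCompactSupport χ) (hχO : tsupport χ ⊆ O) {s : X → E} (hs : ContinuousOn s O) :
    ∃ f : C₀(X, E), ∀ x, f x = χ x • s x := by
  have hc : Continuous fun x => χ x • s x := by
    refine (hχ.continuousOn.smul hs).continuous_of_tsupport_subset hO ?_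
    exact (tsupport_smul_subset_left χ s).trans hχO
  exact ⟨⟨⟨_, hc⟩, (hχc.smul_right (f' := s)).is_zero_at_infty⟩, fun x => rfl⟩

theorem exists_C0_apply_eq [T2Space X] [LocallyCompactSpace X] (x : X) (v : E) :
    ∃ f : C₀(X, E), f x = v := by
  obtain ⟨χ, hχ, -, -, h1, hχc, -⟩ := exists_cutoff isOpen_univ (isCompact_singleton (x := x))
    (Set.subset_univ _)
  obtain ⟨f, hf⟩ := exists_C0_smul isOpen_univ hχ hχc (Set.subset_univ _)
    (continuousOn_const (c := v))
  exact ⟨f, by rw [hf, h1 x rfl, one_smul]⟩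

/-- Functions with values in a dense subspace approximate: one may even project onto a finite
dimensional subspace of it. -/
theorem exists_finiteDimensional_norm_sub_le {H : Type*} [NormedAddCommGroup H]
    [InnerProductSpace ℂ H] {V : Submodule ℂ H} (hV : Dense (V : Set H)) (f : C₀(X, H)) {ε : ℝ}
    (hε : 0 < ε) : ∃ (W : Submodule ℂ H) (_ : FiniteDimensional ℂ W), W ≤ V ∧
      ‖f - mapC0 W.starProjection f‖ ≤ ε := by
  have hK : ∃ K : Set X, IsCompact K ∧ ∀ x ∉ K, ‖f x‖ ≤ ε := by
    have h := (zero_at_infty f).norm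
    rw [norm_zero] at h
    obtain ⟨K, hK, hKf⟩ := mem_cocompact.1 (h.eventually_le_const hε)
    exact ⟨K, hK, fun x hx => hKf hx⟩
  obtain ⟨K, hK, hKf⟩ := hK
  -- Finitely many balls of radius ε with centres in `V` cover the compact set `f(K)`; the centres
  -- span `W`. Orthogonal projection onto `W` is at least as good as the nearest centre on `K`, and
  -- as the vector 0 off `K`.
  obtain ⟨t, ht⟩ := (hK.image (map_continuous f)).elim_finite_subcover
    (fun v : V => Metric.ball (v : H) ε) (fun _ => Metric.isOpen_ball) (by
      rintro - ⟨x, -, rfl⟩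
      obtain ⟨v, hv, hd⟩ := Metric.dense_iff.1 hV (f x) ε hε
      exact Set.mem_iUnion.2 ⟨⟨v, hd⟩, by rw [Metric.mem_ball'] ; exact Metric.mem_ball.1 hv⟩)
  let W : Submodule ℂ H := Submodule.span ℂ ((fun v : V => (v : H)) '' t)
  have hW : FiniteDimensional ℂ W := FiniteDimensional.span_of_finite ℂ (t.finite_toSet.image _)
  refine ⟨W, hW, ?_, norm_C0_le hε.le fun x => ?_⟩
  · rw [Submodule.span_le]
    rintro - ⟨v, -, rfl⟩
    exact v.2
  · change ‖f x - W.starProjection (f x)‖ ≤ ε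
    have hmin : ∀ w ∈ W, ‖f x - W.starProjection (f x)‖ ≤ ‖f x - w‖ := by
      intro w hw
      rw [Submodule.starProjection_minimal]
      exact ciInf_le ⟨0, by rintro - ⟨y, rfl⟩; exact norm_nonneg _⟩ (⟨w, hw⟩ : W)
    by_cases hx : x ∈ K
    · obtain ⟨v, hv, hd⟩ := Set.mem_iUnion₂.1 (ht ⟨x, hx, rfl⟩)
      refine (hmin v (Submodule.subset_span ⟨v, hv, rfl⟩)).trans ?_
      rw [← dist_eq_norm]
      exact (Metric.mem_ball.1 hd).le
    · refine (hmin 0 W.zero_mem).trans ?_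
      rw [sub_zero]
      exact hKf x hx

end ZeroAtInfinity

/-! ### The operators `T_Λ` in the Hilbert module: adjoint, selfadjointness, failure of regularity
-/

section ModuleOperators

variable {X : Type v} [TopologicalSpace X]
variable {H : Type u} [NormedAddCommGroup H] [InnerProductSpace ℂ H]

/-- The value at `x` of a pair of functions, as an element of the Hilbert sum. -/
def pairAt (p : C₀(X, H) × C₀(X, H)) (x : X) : WithLp 2 (H × H) := WithLp.toLp 2 (p.1 x, p.2 x)

omit [InnerProductSpace ℂ H] in
theorem continuous_pairAt (p : C₀(X, H) × C₀(X, H)) : Continuous (pairAt p) :=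
  (WithLp.prod_continuous_toLp 2 H H).comp ((map_continuous p.1).prodMk (map_continuous p.2))

omit [InnerProductSpace ℂ H] in
theorem continuous_pairAt_left (x : X) :
    Continuous fun p : C₀(X, H) × C₀(X, H) => pairAt p x :=
  (WithLp.prod_continuous_toLp 2 H H).comp
    (((continuous_C0_eval x).comp continuous_fst).prodMk
      ((continuous_C0_eval x).comp continuous_snd))

/-- The pair of functions given by a function with values in the Hilbert sum. -/
def ofPair (f : C₀(X, WithLp 2 (H × H))) : C₀(X, H) × C₀(X, H) :=
  (mapC0 (WithLp.fstL 2 ℂ H H) f, mapC0 (WithLp.sndL 2 ℂ H H) f)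

theorem pairAt_ofPair (f : C₀(X, WithLp 2 (H × H))) (x : X) : pairAt (ofPair f) x = f x := rfl

theorem mem_adjointGraph_iff {T : C₀(X, H) →ₗ.[ℂ] C₀(X, H)} {p : C₀(X, H) × C₀(X, H)} :
    p ∈ adjointGraph T ↔ ∀ q ∈ T.graph, ∀ x, inner ℂ (pairAt p x).fst (pairAt q x).snd =
      inner ℂ (pairAt p x).snd (pairAt q x).fst := by
  constructor
  · intro h q hq x
    obtain ⟨ξ, h1, h2⟩ := (LinearPMap.mem_graph_iff _).1 hq
    have := DFunLike.congr_fun (h ξ) x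
    change inner ℂ (p.1 x) (T ξ x) = inner ℂ (p.2 x) ((ξ : C₀(X, H)) x) at this
    rw [h1, h2] at this
    exact this
  · intro h ξ
    ext x
    exact h _ (T.mem_graph ξ) x

variable [CompleteSpace H] (B : DeficiencyOne H)

theorem mem_Tmax_graph {p : C₀(X, H) × C₀(X, H)} : p ∈ (Tmax B X).graph ↔
    ∀ x, pairAt p x ∈ l2Graph B.Dmax := by
  rw [Tmax_graph]; rfl

theorem mem_TLam_graph {Λ : X → Circle} {p : C₀(X, H) × C₀(X, H)} : p ∈ (TLam B Λ).graph ↔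
    ∀ x, pairAt p x ∈ B.extGraph (Λ x) := by
  have hext : ∀ l (ξ : WithLp 2 (H × H)), ξ ∈ B.extGraph l ↔
      ξ ∈ l2Graph B.Dmax ∧ ξ.fst ∈ B.extDomain l := by
    intro l ξ
    constructor
    · intro h
      refine ⟨B.extGraph_le l h, ?_⟩
      obtain ⟨a, h1, -⟩ := (LinearPMap.mem_graph_iff _).1 (mem_l2Graph.1 h)
      exact (show (a : H) = ξ.fst from h1) ▸ a.2.1
    · rintro ⟨h, hd⟩
      obtain ⟨a, h1, h2⟩ := (LinearPMap.mem_graph_iff _).1 (mem_l2Graph.1 h)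
      refine (LinearPMap.mem_graph_iff _).2 ⟨⟨ξ.fst, hd, (show (a : H) = ξ.fst from h1) ▸ a.2⟩, rfl, ?_⟩
      exact (LinearPMap.domRestrict_apply (f := B.Dmax) (y := a) h1.symm).trans h2
  constructor
  · intro h x
    obtain ⟨a, h1, h2⟩ := (LinearPMap.mem_graph_iff _).1 h
    refine (hext _ _).2 ⟨?_, ?_⟩
    · exact mem_Tmax_graph B |>.1 (LinearPMap.le_graph_of_le (LinearPMap.domRestrict_le) h) x
    · have := a.2.1 x
      rw [h1] at this
      exact this
  · intro h
    have hmax : p ∈ (Tmax B X).graph := (mem_Tmax_graph B).2 fun x => B.extGraph_le _ (h x)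
    obtain ⟨a, h1, h2⟩ := (LinearPMap.mem_graph_iff _).1 hmax
    refine (LinearPMap.mem_graph_iff _).2
      ⟨⟨p.1, fun x => ((hext _ _).1 (h x)).2, h1 ▸ a.2⟩, rfl, ?_⟩
    rw [← h2]
    exact LinearPMap.domRestrict_apply (f := Tmax B X) (y := a) h1.symm

theorem isClosed_TLam (Λ : X → Circle) : (TLam B Λ).IsClosed := by
  have : ((TLam B Λ).graph : Set (C₀(X, H) × C₀(X, H))) =
      ⋂ x, {p | pairAt p x ∈ B.extGraph (Λ x)} := by
    ext p
    rw [Set.mem_iInter]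
    exact mem_TLam_graph B
  rw [LinearPMap.IsClosed, this]
  exact isClosed_iInter fun x => (B.isClosed_extGraph _).preimage (continuous_pairAt_left x)

omit [CompleteSpace H] in
/-- The restriction of a linear operator to a finite dimensional subspace of its domain. -/
theorem exists_clm_graph {W : Submodule ℂ H} [FiniteDimensional ℂ W] {T : H →ₗ.[ℂ] H}
    (hW : W ≤ T.domain) : ∃ L : H →L[ℂ] H, ∀ v, (W.starProjection v, L v) ∈ T.graph := by
  refine ⟨(LinearMap.toContinuousLinearMap (T.toFun ∘ₗ Submodule.inclusion hW)) ∘L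
    W.orthogonalProjectionOnto, fun v => ?_⟩
  exact T.mem_graph (Submodule.inclusion hW (W.orthogonalProjectionOnto v))

/-- Functions with values in a finite dimensional subspace of dom(D) are already dense. On such a
subspace `D` is bounded, and every boundary condition holds there trivially. -/
theorem dense_domain_TLam (Λ : X → Circle) : Dense ((TLam B Λ).domain : Set C₀(X, H)) := by
  refine Metric.dense_iff.2 fun f ε hε => ?_
  obtain ⟨W, hW, hWD, hf⟩ := exists_finiteDimensional_norm_sub_le B.dense_domain f
    (half_pos hε)
  obtain ⟨L, hL⟩ := exists_clm_graph hWD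
  refine ⟨mapC0 W.starProjection f, ?_, ?_⟩
  · rw [Metric.mem_ball', dist_eq_norm]
    linarith
  · refine LinearPMap.mem_domain_iff.2 ⟨mapC0 L f, (mem_TLam_graph B).2 fun x => ?_⟩
    exact B.D_le_extGraph _ (hL (f x))

theorem TLam_le_adjointGraph (Λ : X → Circle) : (TLam B Λ).graph ≤ adjointGraph (TLam B Λ) :=
  fun _ hp => mem_adjointGraph_iff.2 fun _ hq x =>
    B.mem_extGraph_iff_forall.1 ((mem_TLam_graph B).1 hp x) _ ((mem_TLam_graph B).1 hq x)

theorem isSemiregular_TLam (Λ : X → Circle) : IsSemiregular (TLam B Λ) where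
  smul_mem a f hf := by
    obtain ⟨g, hg⟩ := LinearPMap.mem_domain_iff.1 hf
    refine LinearPMap.mem_domain_iff.2 ⟨modSMul a g, (mem_TLam_graph B).2 fun x => ?_⟩
    exact (B.extGraph (Λ x)).smul_mem (a x) ((mem_TLam_graph B).1 hg x)
  dense_domain := dense_domain_TLam B Λ
  dense_adjoint := (dense_domain_TLam B Λ).mono fun f hf => by
    obtain ⟨g, hg⟩ := LinearPMap.mem_domain_iff.1 hf
    exact ⟨g, TLam_le_adjointGraph B Λ hg⟩

theorem isOpen_reg (Λ : X → Circle) : IsOpen (reg Λ) := by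
  refine isOpen_iff_forall_mem_open.2 ?_
  rintro p ⟨U, hU, hp, hc⟩
  exact ⟨U, fun q hq => ⟨U, hU, hq, hc⟩, hU, hp⟩

theorem continuousOn_reg (Λ : X → Circle) : ContinuousOn Λ (reg Λ) := by
  rintro p ⟨U, hU, hp, hc⟩
  exact (hc.continuousAt (hU.mem_nhds hp)).continuousWithinAt

theorem frontier_reg {Λ : X → Circle} (hΛ : closure (reg Λ) = Set.univ) :
    frontier (reg Λ) = (reg Λ)ᶜ := by
  rw [frontier, hΛ, (isOpen_reg Λ).interior_eq, Set.compl_eq_univ_sdiff]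

variable [T2Space X] [LocallyCompactSpace X]

/-- Sections of the graph bundle over the open set where `l` is continuous. -/
theorem exists_pairAt_eq {O : Set X} (hO : IsOpen O) {l : X → Circle} (hl : ContinuousOn l O)
    {x : X} (hx : x ∈ O) {q : WithLp 2 (H × H)} (hq : q ∈ B.extGraph (l x)) :
    ∃ p : C₀(X, H) × C₀(X, H), pairAt p x = q ∧ (∀ y ∈ O, pairAt p y ∈ B.extGraph (l y)) ∧
      ∀ y ∉ O, pairAt p y = 0 := by
  obtain ⟨χ, hχ, -, -, h1, hχc, hχO⟩ := exists_cutoff hO (isCompact_singleton (x := x))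
    (Set.singleton_subset_iff.2 hx)
  obtain ⟨f, hf⟩ := exists_C0_smul hO hχ hχc hχO (s := fun y => B.extProj (l y) q)
    ((B.continuous_extProj.comp_continuousOn hl).clm_apply continuousOn_const)
  refine ⟨ofPair f, ?_, fun y hy => ?_, fun y hy => ?_⟩
  · rw [pairAt_ofPair, hf, h1 x rfl, one_smul, B.extProj_eq_self hq]
  · rw [pairAt_ofPair, hf]
    exact Submodule.smul_mem _ _ (B.extProj_mem _ _)
  · rw [pairAt_ofPair, hf, image_eq_zero_of_notMem_tsupport fun h => hy (hχO h), zero_smul]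

/-- Over `reg Λ` every vector of the fibre graph is the value of a section in the graph of `T_Λ`.
The adjoint relation at x therefore tests against all of `D_{Λ(x)}`, which is selfadjoint. -/
theorem pairAt_mem_extGraph_of_adjoint {Λ : X → Circle} {p : C₀(X, H) × C₀(X, H)}
    (hp : p ∈ adjointGraph (TLam B Λ)) {x : X} (hx : x ∈ reg Λ) :
    pairAt p x ∈ B.extGraph (Λ x) := by
  rw [B.mem_extGraph_iff_forall]
  intro q hq
  obtain ⟨r, hr, hr1, hr0⟩ := exists_pairAt_eq B (isOpen_reg Λ) (continuousOn_reg Λ) hx hq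
  rw [← hr]
  refine mem_adjointGraph_iff.1 hp r ((mem_TLam_graph B).2 fun y => ?_) x
  by_cases hy : y ∈ reg Λ
  · exact hr1 y hy
  · rw [hr0 y hy]; exact zero_mem _

/-- Cutoffs times a constant vector in the graph of `D` belong to the graph of `T_Λ` for any Λ, so
they may be used as test sections at singular points too. -/
theorem pairAt_mem_Dmax_of_adjoint {Λ : X → Circle} {p : C₀(X, H) × C₀(X, H)}
    (hp : p ∈ adjointGraph (TLam B Λ)) (x : X) : pairAt p x ∈ l2Graph B.Dmax := by
  rw [B.mem_Dmax_iff]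
  intro q hq
  obtain ⟨χ, hχ, -, -, h1, hχc, hχO⟩ := exists_cutoff isOpen_univ (isCompact_singleton (x := x))
    (Set.subset_univ _)
  obtain ⟨f, hf⟩ := exists_C0_smul isOpen_univ hχ hχc hχO (continuousOn_const (c := q))
  have hfx : pairAt (ofPair f) x = q := by rw [pairAt_ofPair, hf, h1 x rfl, one_smul]
  rw [← hfx]
  refine mem_adjointGraph_iff.1 hp _ ((mem_TLam_graph B).2 fun y => ?_) x
  rw [pairAt_ofPair, hf]
  exact Submodule.smul_mem _ _ (B.D_le_extGraph _ hq)

/-- The boundary condition extends by continuity along a continuous extension of `Λ`. -/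
theorem inner_vp_pairAt_of_adjoint {Λ : X → Circle} (hΛ : closure (reg Λ) = Set.univ)
    {U : Set X} (hU : IsOpen U) {Λ' : X → Circle} (hc : ContinuousOn Λ' U)
    (he : ∀ q ∈ U ∩ reg Λ, Λ' q = Λ q) {p : C₀(X, H) × C₀(X, H)}
    (hp : p ∈ adjointGraph (TLam B Λ)) {x : X} (hx : x ∈ U) :
    inner ℂ B.vp (pairAt p x) = Λ' x * inner ℂ B.vm (pairAt p x) := by
  have hpc := continuous_pairAt p
  have h : Set.EqOn (fun x => inner ℂ B.vp (pairAt p x))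
      (fun x => (Λ' x : ℂ) * inner ℂ B.vm (pairAt p x)) U := by
    refine Set.EqOn.of_subset_closure (s := U ∩ reg Λ) (fun y hy => ?_)
      (continuous_const.inner hpc).continuousOn
      ((continuous_subtype_val.comp_continuousOn hc).mul
        (continuous_const.inner hpc).continuousOn) Set.inter_subset_left
      (Dense.open_subset_closure_inter (dense_iff_closure_eq.2 hΛ) hU)
    rw [he y hy]
    exact (B.mem_extGraph.1 (pairAt_mem_extGraph_of_adjoint B hp hy.2)).2
  exact h hx

/-- Where α₋ ≠ 0, the quotient α₊/α₋ is continuous and agrees with Λ on `reg Λ`. If α₋ were nonzero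
at x, this quotient would put x into `regInfty Λ`. -/
theorem inner_pairAt_eq_zero_of_mem_ssuppR {Λ : X → Circle} (hΛ : closure (reg Λ) = Set.univ)
    {x : X} (hx : x ∈ ssuppR Λ) {p : C₀(X, H) × C₀(X, H)} (hp : p ∈ adjointGraph (TLam B Λ)) :
    inner ℂ B.vp (pairAt p x) = 0 ∧ inner ℂ B.vm (pairAt p x) = 0 := by
  have hpc := continuous_pairAt p
  have ha : Continuous fun x => (inner ℂ B.vp (pairAt p x) : ℂ) := continuous_const.inner hpc
  have hb : Continuous fun x => (inner ℂ B.vm (pairAt p x) : ℂ) := continuous_const.inner hpc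
  have hreg : ∀ y ∈ reg Λ, (inner ℂ B.vp (pairAt p y) : ℂ) = Λ y * inner ℂ B.vm (pairAt p y) :=
    fun y hy => (B.mem_extGraph.1 (pairAt_mem_extGraph_of_adjoint B hp hy)).2
  -- The equality |α₊| = |α₋| passes from the dense set `reg Λ` to all of `X`, although the phase
  -- need not have a limit. It makes the quotient circle-valued.
  have hnorm : ∀ y, ‖(inner ℂ B.vp (pairAt p y) : ℂ)‖ = ‖(inner ℂ B.vm (pairAt p y) : ℂ)‖ := by
    have h := Continuous.ext_on (dense_iff_closure_eq.2 hΛ) ha.norm hb.norm (fun y hy => by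
      rw [hreg y hy, norm_mul, Circle.norm_coe, one_mul])
    exact fun y => congrFun h y
  suffices h : inner ℂ B.vm (pairAt p x) = (0 : ℂ) by
    refine ⟨?_, h⟩
    rw [← norm_eq_zero, hnorm, h, norm_zero]
  by_contra hne
  refine hx.2 ⟨?_, {y | (inner ℂ B.vm (pairAt p y) : ℂ) ≠ 0}, isOpen_ne_fun hb continuous_const,
    hne, ?_⟩
  · have := hx.1
    rwa [ssupp, frontier_compl] at this
  have hex : ∀ y, ∃ c : Circle, (inner ℂ B.vm (pairAt p y) : ℂ) ≠ 0 →
      (c : ℂ) = inner ℂ B.vp (pairAt p y) / inner ℂ B.vm (pairAt p y) := by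
    intro y
    by_cases h : (inner ℂ B.vm (pairAt p y) : ℂ) = 0
    · exact ⟨1, fun h' => absurd h h'⟩
    · refine ⟨⟨inner ℂ B.vp (pairAt p y) / inner ℂ B.vm (pairAt p y),
        mem_sphere_zero_iff_norm.2 ?_⟩, fun _ => rfl⟩
      rw [norm_div, hnorm, div_self (norm_ne_zero_iff.2 h)]
  choose c hc using hex
  have hind : Topology.IsInducing ((↑) : Circle → ℂ) := Topology.IsInducing.subtypeVal
  refine ⟨c, hind.continuousOn_iff.2 ?_, ?_⟩
  · exact (ha.continuousOn.div hb.continuousOn fun y hy => hy).congr fun y hy => hc y hy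
  · rintro y ⟨hy, hyr⟩
    refine Circle.ext ?_
    rw [hc y hy, hreg y hyr, mul_div_cancel_right₀ _ hy]

theorem isModuleSelfAdjoint_TLam {Λ : X → Circle} (hΛ : closure (reg Λ) = Set.univ)
    (h : frontier (reg Λ) = ssuppR Λ) : IsModuleSelfAdjoint (TLam B Λ) where
  dense_domain := dense_domain_TLam B Λ
  graph_eq := by
    refine le_antisymm (TLam_le_adjointGraph B Λ) fun p hp => (mem_TLam_graph B).2 fun x => ?_
    by_cases hx : x ∈ reg Λ
    · exact pairAt_mem_extGraph_of_adjoint B hp hx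
    · have hx' : x ∈ ssuppR Λ := by rw [← h, frontier_reg hΛ]; exact hx
      obtain ⟨h1, h2⟩ := inner_pairAt_eq_zero_of_mem_ssuppR B hΛ hx' hp
      refine B.mem_extGraph.2 ⟨pairAt_mem_Dmax_of_adjoint B hp x, ?_⟩
      rw [h1, h2, mul_zero]

omit [CompleteSpace H] in
/-- If all elements of the domain satisfy both boundary conditions at a point, while
the elements of the adjoint graph satisfy the boundary condition given by `w`, then `T` is not
regular. -/
theorem not_isRegular_of_inner_eq_zero {T : C₀(X, H) →ₗ.[ℂ] C₀(X, H)} {x : X}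
    {w : WithLp 2 (H × H)} (hw : w.fst ≠ 0)
    (hT : ∀ p ∈ T.graph, inner ℂ w (pairAt p x) = 0)
    (hadj : ∀ p ∈ adjointGraph T, inner ℂ w.fst (pairAt p x).snd =
      inner ℂ w.snd (pairAt p x).fst) : ¬ IsRegular T := by
  intro h
  have hcl : IsClosed {y : C₀(X, H) | inner ℂ w.fst (y x) = 0} :=
    isClosed_eq (continuous_const.inner (continuous_C0_eval x)) continuous_const
  -- The values of (f, Tf) at x are orthogonal to w in the graph product. The adjoint relation moves
  -- the second term of that product onto z = T^*Tf, so `w.fst` is orthogonal to f(x) + z(x).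
  have hsub : {y : C₀(X, H) | ∃ (f : T.domain) (z : C₀(X, H)), (T f, z) ∈ adjointGraph T ∧
      y = (f : C₀(X, H)) + z} ⊆ {y : C₀(X, H) | inner ℂ w.fst (y x) = 0} := by
    rintro - ⟨f, z, hz, rfl⟩
    have h1 := hT _ (T.mem_graph f)
    have h2 := hadj _ hz
    rw [l2_inner] at h1
    change inner ℂ w.fst (z x) = inner ℂ w.snd (T f x) at h2
    change inner ℂ w.fst ((f : C₀(X, H)) x) + inner ℂ w.snd (T f x) = 0 at h1
    change inner ℂ w.fst ((f : C₀(X, H)) x + z x) = 0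
    rw [inner_add_right, h2, h1]
  obtain ⟨y, hy⟩ := exists_C0_apply_eq x w.fst
  have hmem : y ∈ closure {y : C₀(X, H) | ∃ (f : T.domain) (z : C₀(X, H)),
      (T f, z) ∈ adjointGraph T ∧ y = (f : C₀(X, H)) + z} := h.dense_range y
  have h0 : inner ℂ w.fst (y x) = 0 := closure_minimal hsub hcl hmem
  rw [hy, inner_self_eq_zero] at h0
  exact hw h0

/-- At such a point all values of the adjoint graph lie in the graph of `D`, so they pair correctly
with any vector of the graph of `D^*`, in particular with `vp`. -/
theorem not_isRegular_TLam_of_ssuppR {Λ : X → Circle} (hΛ : closure (reg Λ) = Set.univ)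
    (hne : (ssuppR Λ).Nonempty) : ¬ IsRegular (TLam B Λ) := by
  obtain ⟨x, hx⟩ := hne
  refine not_isRegular_of_inner_eq_zero (x := x) (w := B.vp) B.φp_ne_zero (fun p hp => ?_)
    fun p hp => ?_
  · exact (inner_pairAt_eq_zero_of_mem_ssuppR B hΛ hx (TLam_le_adjointGraph B Λ hp)).1
  · obtain ⟨h1, h2⟩ := inner_pairAt_eq_zero_of_mem_ssuppR B hΛ hx hp
    exact B.mem_Dmax_iff.1 B.vp_mem _
      (B.mem_D_of_inner_eq_zero (pairAt_mem_Dmax_of_adjoint B hp x) h1 h2)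

omit [T2Space X] [LocallyCompactSpace X] in
/-- Near a point of `reg_∞ Λ` the continuous extension differs from `Λ` somewhere. -/
theorem exists_extension_ne {Λ : X → Circle} (hne : (regInfty Λ).Nonempty) :
    ∃ (U : Set X) (Λ' : X → Circle) (q : X), IsOpen U ∧ ContinuousOn Λ' U ∧
      (∀ y ∈ U ∩ reg Λ, Λ' y = Λ y) ∧ q ∈ U ∧ Λ' q ≠ Λ q := by
  obtain ⟨p, hp, U, hU, hpU, Λ', hc, he⟩ := hne
  have hpr : p ∉ reg Λ := by
    rw [frontier, (isOpen_reg Λ).interior_eq] at hp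
    exact hp.2
  by_contra! hcon
  refine hpr ⟨U, hU, hpU, hc.congr fun y hy => ?_⟩
  exact (hcon U Λ' y hU hc he hy).symm

theorem not_isModuleSelfAdjoint_TLam {Λ : X → Circle} (hΛ : closure (reg Λ) = Set.univ)
    (hne : (regInfty Λ).Nonempty) : ¬ IsModuleSelfAdjoint (TLam B Λ) := by
  intro h
  obtain ⟨U, Λ', q, hU, hc, he, hq, hqne⟩ := exists_extension_ne hne
  -- A section obeying the boundary condition of Λ' and vanishing off `U`. By density, elements of
  -- the graph of `T_Λ` obey that condition on `U` as well, so this section is in the adjoint graph;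
  -- at q it violates the condition of Λ.
  obtain ⟨p, hpq, hpU, hp0⟩ := exists_pairAt_eq B hU hc hq (B.bdryVec_mem (Λ' q))
  have hp : p ∈ adjointGraph (TLam B Λ) := by
    rw [mem_adjointGraph_iff]
    intro r hr x
    by_cases hx : x ∈ U
    · refine B.mem_extGraph_iff_forall.1 (hpU x hx) _ (B.mem_extGraph.2 ⟨?_, ?_⟩)
      · exact pairAt_mem_Dmax_of_adjoint B (TLam_le_adjointGraph B Λ hr) x
      · exact inner_vp_pairAt_of_adjoint B hΛ hU hc he (TLam_le_adjointGraph B Λ hr) hx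
    · rw [hp0 x hx]
      simp
  rw [← h.graph_eq, mem_TLam_graph] at hp
  have h1 := (B.mem_extGraph.1 (hp q)).2
  rw [hpq, B.inner_vp_bdryVec, B.inner_vm_bdryVec, mul_one] at h1
  exact hqne (Circle.ext h1)

/-- The obstruction is the boundary vector for Λ'(q). In the domain, α₊ = Λ(q) α₋ and α₊ = Λ'(q) α₋
force α₊ = α₋ = 0, hence orthogonality to it; the adjoint graph satisfies the condition for Λ'(q).
-/
theorem not_isRegular_TLam_of_regInfty {Λ : X → Circle} (hΛ : closure (reg Λ) = Set.univ)
    (hne : (regInfty Λ).Nonempty) : ¬ IsRegular (TLam B Λ) := by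
  obtain ⟨U, Λ', q, hU, hc, he, hq, hqne⟩ := exists_extension_ne hne
  have hw : (B.bdryVec (Λ' q)).fst ≠ 0 := by
    intro h0
    have h1 : (B.bdryVec (Λ' q)).snd = 0 :=
      LinearPMap.graph_fst_eq_zero_snd _ (mem_l2Graph.1 (B.bdryVec_mem (Λ' q))) h0
    have h2 := B.inner_vm_bdryVec (Λ' q)
    rw [l2_inner, h0, h1] at h2
    simp at h2
  refine not_isRegular_of_inner_eq_zero (x := q) hw (fun p hp => ?_) fun p hp => ?_
  · have h1 := inner_vp_pairAt_of_adjoint B hΛ hU hc he (TLam_le_adjointGraph B Λ hp) hq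
    have h2 := (B.mem_extGraph.1 ((mem_TLam_graph B).1 hp q)).2
    have h3 : ((Λ' q : ℂ) - Λ q) * inner ℂ B.vm (pairAt p q) = 0 := by
      linear_combination h2 - h1
    have h4 : inner ℂ B.vm (pairAt p q) = 0 :=
      (mul_eq_zero.1 h3).resolve_left fun h => hqne (Circle.ext (sub_eq_zero.1 h))
    rw [h4, mul_zero] at h1
    rw [DeficiencyOne.bdryVec, inner_add_left, inner_smul_left, h1, h4, mul_zero, add_zero]
  · refine B.mem_extGraph_iff_forall.1 (B.bdryVec_mem (Λ' q)) _ (B.mem_extGraph.2 ⟨?_, ?_⟩)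
    · exact pairAt_mem_Dmax_of_adjoint B hp q
    · exact inner_vp_pairAt_of_adjoint B hΛ hU hc he hp hq

end ModuleOperators

/-! ### Localization of operators given by a field of closed graphs -/

section FiberwiseGraph

variable {X : Type v} [TopologicalSpace X] [MeasurableSpace X] [BorelSpace X]
variable {H : Type u} [NormedAddCommGroup H] [InnerProductSpace ℂ H]
variable {μ : Measure X}

omit [BorelSpace X] in
theorem isOpenPosMeasure_of_support_eq_univ (h : μ.support = Set.univ) : μ.IsOpenPosMeasure where
  open_pos U hU hne := by
    obtain ⟨x, hx⟩ := hne
    have hxs : x ∈ μ.support := h ▸ Set.mem_univ x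
    exact ((Measure.mem_support_iff_forall x).1 hxs U (hU.mem_nhds hx)).ne'

/-- A pair of elements of `L²(X, μ; H)`, as a function with values in the Hilbert sum. -/
def lpPair (f g : Lp H 2 μ) (x : X) : WithLp 2 (H × H) := WithLp.toLp 2 (f x, g x)

omit [TopologicalSpace X] [BorelSpace X] in
theorem memLp_toLp_pair {f g : X → H} (hf : MemLp f 2 μ) (hg : MemLp g 2 μ) :
    MemLp (fun x => WithLp.toLp 2 (f x, g x)) 2 μ := by
  let e := (WithLp.prodContinuousLinearEquiv 2 ℂ H H).symm.toContinuousLinearMap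
  have h1 := (e ∘L ContinuousLinearMap.inl ℂ H H).comp_memLp' hf
  have h2 := (e ∘L ContinuousLinearMap.inr ℂ H H).comp_memLp' hg
  refine (h1.add h2).ae_eq (Eventually.of_forall fun x => ?_)
  refine WithLp.ofLp_injective 2 (Prod.ext ?_ ?_)
  · exact add_zero (f x)
  · exact zero_add (g x)

omit [TopologicalSpace X] [BorelSpace X] in
theorem memLp_lpPair (f g : Lp H 2 μ) : MemLp (lpPair f g) 2 μ :=
  memLp_toLp_pair (Lp.memLp f) (Lp.memLp g)

omit [TopologicalSpace X] [BorelSpace X] in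
/-- Membership in closed fibres almost everywhere is a closed condition. -/
theorem ae_lpPair_mem_of_mem_closure {G : X → Submodule ℂ (WithLp 2 (H × H))}
    (hG : ∀ x, IsClosed (G x : Set (WithLp 2 (H × H)))) {S : Set (Lp H 2 μ × Lp H 2 μ)}
    (hS : ∀ p ∈ S, ∀ᵐ x ∂μ, lpPair p.1 p.2 x ∈ G x) {p : Lp H 2 μ × Lp H 2 μ}
    (hp : p ∈ closure S) : ∀ᵐ x ∂μ, lpPair p.1 p.2 x ∈ G x := by
  obtain ⟨s, hs, hlim⟩ := mem_closure_iff_seq_limit.1 hp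
  have h1 : Tendsto (fun n => (s n).1) atTop (𝓝 p.1) := (continuous_fst.tendsto _).comp hlim
  have h2 : Tendsto (fun n => (s n).2) atTop (𝓝 p.2) := (continuous_snd.tendsto _).comp hlim
  -- Norm convergence gives convergence almost everywhere only along a subsequence; the second
  -- subsequence is taken inside the first so that both components converge.
  obtain ⟨m, hm, hm1⟩ := (tendstoInMeasure_of_tendsto_Lp h1).exists_seq_tendsto_ae
  obtain ⟨k, hk, hk2⟩ := (tendstoInMeasure_of_tendsto_Lp
    (h2.comp hm.tendsto_atTop)).exists_seq_tendsto_ae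
  filter_upwards [hm1, hk2, ae_all_iff.2 fun n => hS _ (hs n)] with x hx1 hx2 hx
  refine (hG x).mem_of_tendsto (b := atTop) (f := fun n => lpPair (s (m (k n))).1 (s (m (k n))).2 x)
    ?_ (Eventually.of_forall fun n => hx _)
  exact ((WithLp.prod_continuous_toLp 2 H H).tendsto _).comp
    ((hx1.comp hk.tendsto_atTop).prodMk_nhds hx2)

variable [TopologicalSpace.SeparableSpace H]

theorem coeFn_toL2 [IsFiniteMeasure μ] (f : C₀(X, H)) : (toL2 H μ f : X → H) =ᵐ[μ] f :=
  (memLp_of_zeroAtInfty μ 2 f).coeFn_toLp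

theorem continuous_toL2 [IsFiniteMeasure μ] : Continuous (toL2 H μ) := by
  refine AddMonoidHomClass.continuous_of_bound (toL2 H μ)
    ((measureUnivNNReal μ : ℝ) ^ (2 : ℝ≥0∞).toReal⁻¹) ?_
  intro f
  exact Lp.norm_le_of_ae_bound (f := toL2 H μ f) (norm_nonneg f) (by
    filter_upwards [coeFn_toL2 (μ := μ) f] with x hx
    rw [hx]
    exact f.toBCF.norm_coe_le_norm x)
variable [T2Space X] [LocallyCompactSpace X] [IsFiniteMeasure μ] [μ.Regular]

/-- Square integrable sections of a bundle of subspaces, given by bounded projections that are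
continuous over an open set of full measure, are approximated by continuous sections. -/
theorem exists_section_eLpNorm_sub_le {E : Type u} [NormedAddCommGroup E] [NormedSpace ℂ E]
    {O : Set X} (hO : IsOpen O) (hμO : μ Oᶜ = 0) {Q : X → E →L[ℂ] E} (hQ : ContinuousOn Q O)
    (hQ2 : ∀ x, ‖Q x‖ ≤ 2) {F : X → E} (hF : MemLp F 2 μ) (hQF : ∀ᵐ x ∂μ, Q x (F x) = F x)
    {ε : ℝ≥0∞} (hε : ε ≠ 0) : ∃ f : C₀(X, E), (∀ x, ∃ v, f x = Q x v) ∧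
      eLpNorm (fun x => F x - f x) 2 μ ≤ 4 * ε := by
  let _ : NormedSpace ℝ E := NormedSpace.restrictScalars ℝ ℂ E
  obtain ⟨g, hgε, hg, hgc, hgm⟩ := exists_compactSupport_eLpNorm_sub_le μ hF hε
  obtain ⟨C, hC⟩ := hgc.exists_bound_of_continuous hg
  have hC' : ∀ x, ‖g x‖ ≤ |C| := fun x => (hC x).trans (le_abs_self C)
  -- η makes the constant |C| contribute at most ε in L² on any set of measure at most η; the
  -- compact `K` is then chosen so that its complement is such a set.
  obtain ⟨η, hη0, hη⟩ := exists_eLpNorm_indicator_le (μ := μ) (p := 2) (by simp) |C| hε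
  obtain ⟨K, hKO, hK, hKc, hKη⟩ := hO.measurableSet.exists_isCompact_isClosed_sdiff_lt
    (measure_lt_top μ O).ne (ENNReal.coe_pos.2 hη0).ne'
  obtain ⟨χ, hχ, hχ1, h1χ, hχK, hχc, hχO⟩ := exists_cutoff hO hK hKO
  obtain ⟨f, hf⟩ := exists_C0_smul hO hχ hχc hχO (hQ.clm_apply hg.continuousOn)
  refine ⟨f, fun x => ⟨χ x • g x, by rw [hf, map_smul]⟩, ?_⟩
  have hKm : μ Kᶜ ≤ η := by
    have : Kᶜ ⊆ Oᶜ ∪ O \ K := by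
      intro x hx
      by_cases h : x ∈ O
      · exact Or.inr ⟨h, hx⟩
      · exact Or.inl h
    calc μ Kᶜ ≤ μ Oᶜ + μ (O \ K) := (measure_mono this).trans (measure_union_le _ _)
      _ ≤ η := by rw [hμO, zero_add]; exact hKη.le
  have hind := hη Kᶜ hKm
  have hpt : ∀ᵐ x ∂μ, ‖F x - f x‖ ≤
      2 * (‖(F x - g x)‖ + (Kᶜ).indicator (fun _ => |C|) x) := by
    filter_upwards [hQF] with x hx
    -- Since Q fixes F almost everywhere, the error is Q applied to F - χg. The bound 2 on Q and two
    -- errors of size ε account for the factor 4.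
    have e : F x - f x = Q x ((F x - g x) + (1 - χ x) • g x) := by
      rw [hf, sub_smul, one_smul, sub_add_sub_cancel, map_sub, hx,
        map_smul]
    rw [e]
    refine ((Q x).le_opNorm _).trans (mul_le_mul (hQ2 x) ?_ (norm_nonneg _) zero_le_two)
    refine (norm_add_le _ _).trans (add_le_add_right ?_ _)
    by_cases hxK : x ∈ K
    · rw [hχK x hxK, sub_self, zero_smul, norm_zero]
      exact Set.indicator_nonneg (fun _ _ => abs_nonneg C) x
    · rw [Set.indicator_of_mem hxK, norm_smul]
      exact (mul_le_of_le_one_left (norm_nonneg _) (h1χ x)).trans (hC' x)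
  have hm1 : AEStronglyMeasurable (fun x => ‖(F x - g x)‖) μ :=
    (hF.aestronglyMeasurable.sub hgm).norm
  have hm2 : AEStronglyMeasurable ((Kᶜ).indicator fun _ => |C|) μ :=
    aestronglyMeasurable_const.indicator hKc.measurableSet.compl
  calc eLpNorm (fun x => F x - f x) 2 μ
      ≤ eLpNorm ((2 : ℝ) • ((fun x => ‖(F x - g x)‖) + (Kᶜ).indicator fun _ => |C|)) 2 μ :=
        eLpNorm_mono_ae_real hpt
    _ = 2 * eLpNorm ((fun x => ‖(F x - g x)‖) + (Kᶜ).indicator fun _ => |C|) 2 μ := by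
        rw [eLpNorm_const_smul]; simp [enorm]
    _ ≤ 2 * (ε + ε) := by
        gcongr
        refine (eLpNorm_add_le hm1 hm2 (by norm_num)).trans (add_le_add ?_ hind)
        exact (eLpNorm_norm (F - g)).le.trans hgε
    _ = 4 * ε := by rw [← two_mul, ← mul_assoc]; norm_num

omit [T2Space X] [LocallyCompactSpace X] [μ.Regular] in
theorem dist_toL2_le {E : Type u} [NormedAddCommGroup E] [InnerProductSpace ℂ E]
    [TopologicalSpace.SeparableSpace E] {u : Lp E 2 μ} {f : C₀(X, E)} {ε : ℝ} (hε : 0 ≤ ε)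
    (h : eLpNorm (fun x => u x - f x) 2 μ ≤ ENNReal.ofReal ε) : dist u (toL2 E μ f) ≤ ε := by
  rw [Lp.dist_def]
  refine ENNReal.toReal_le_of_le_ofReal hε (le_trans (le_of_eq (eLpNorm_congr_ae ?_)) h)
  filter_upwards [coeFn_toL2 (μ := μ) f] with x hx
  rw [Pi.sub_apply, hx]

/-- The localization of an operator given fibrewise by closed graphs `G x`: its graph consists of
the square integrable sections of `G`. -/
theorem mem_graph_localize_iff [μ.IsOpenPosMeasure] {T : C₀(X, H) →ₗ.[ℂ] C₀(X, H)}
    {G : X → Submodule ℂ (WithLp 2 (H × H))}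
    (hT : ∀ p, p ∈ T.graph ↔ ∀ x, pairAt p x ∈ G x)
    (hG : ∀ x, IsClosed (G x : Set (WithLp 2 (H × H))))
    (hG0 : ∀ x, ∀ q ∈ G x, q.fst = 0 → q.snd = 0)
    {O : Set X} (hO : IsOpen O) (hμO : μ Oᶜ = 0)
    {Q : X → WithLp 2 (H × H) →L[ℂ] WithLp 2 (H × H)} (hQ : ContinuousOn Q O)
    (hQ2 : ∀ x, ‖Q x‖ ≤ 2) (hQmem : ∀ x v, Q x v ∈ G x) (hQid : ∀ x, ∀ v ∈ G x, Q x v = v)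
    {f g : Lp H 2 μ} :
    (f, g) ∈ (localize μ T).graph ↔ ∀ᵐ x ∂μ, lpPair f g x ∈ G x := by
  have hgraph : (localize₀ μ T).graph = T.graph.map ((toL2 H μ).prodMap (toL2 H μ)) := by
    refine Submodule.toLinearPMap_graph_eq _ ?_
    rintro - ⟨⟨a, b⟩, hab, rfl⟩ h0
    change toL2 H μ a = 0 at h0
    have ha : (a : X → H) =ᵐ[μ] (0 : C₀(X, H)) := by
      have h1 := coeFn_toL2 (μ := μ) a
      rw [h0] at h1
      exact h1.symm.trans (Lp.coeFn_zero H 2 μ)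
    -- As `μ` charges nonempty open sets, a continuous function vanishing almost everywhere is zero;
    -- so [f] ↦ [Tf] is well defined.
    have ha' := (map_continuous a).ae_eq_iff_eq μ (map_continuous (0 : C₀(X, H))) |>.1 ha
    have hb : b = 0 := by
      ext x
      exact hG0 x _ ((hT _).1 hab x) (congrFun ha' x)
    change toL2 H μ b = 0
    rw [hb, map_zero]
  have hsub : ∀ p ∈ (localize₀ μ T).graph, ∀ᵐ x ∂μ, lpPair p.1 p.2 x ∈ G x := by
    intro p hp
    rw [hgraph] at hp
    obtain ⟨⟨a, b⟩, hab, rfl⟩ := hp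
    filter_upwards [coeFn_toL2 (μ := μ) a, coeFn_toL2 (μ := μ) b] with x ha hb
    have h := (hT _).1 hab x
    change WithLp.toLp 2 ((toL2 H μ a : X → H) x, (toL2 H μ b : X → H) x) ∈ G x
    rw [ha, hb]
    exact h
  have hclosable : (localize₀ μ T).IsClosable := by
    refine ⟨(localize₀ μ T).graph.topologicalClosure.toLinearPMap,
      (Submodule.toLinearPMap_graph_eq _ ?_).symm⟩
    intro p hp h0
    have h := ae_lpPair_mem_of_mem_closure hG hsub hp
    refine Lp.ext ?_
    filter_upwards [h, Lp.coeFn_zero H 2 μ] with x hx hx0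
    rw [hx0]
    refine hG0 x _ hx ?_
    change p.1 x = 0
    rw [h0, hx0]; rfl
  rw [localize, ← hclosable.graph_closure_eq_closure_graph, ← SetLike.mem_coe,
    Submodule.topologicalClosure_coe]
  refine ⟨fun h => ae_lpPair_mem_of_mem_closure hG hsub h, fun h => ?_⟩
  refine Metric.mem_closure_iff.2 fun ε hε => ?_
  obtain ⟨s, hs, hsε⟩ := exists_section_eLpNorm_sub_le hO hμO hQ hQ2 (memLp_lpPair f g)
    (h.mono fun x hx => hQid x _ hx) (ε := ENNReal.ofReal (ε / 8)) (by simpa using hε)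
  have hε' : (4 : ℝ≥0∞) * ENNReal.ofReal (ε / 8) = ENNReal.ofReal (ε / 2) := by
    rw [show (4 : ℝ≥0∞) = ENNReal.ofReal 4 by simp, ← ENNReal.ofReal_mul (by norm_num)]
    congr 1; ring
  rw [hε'] at hsε
  refine ⟨(toL2 H μ (ofPair s).1, toL2 H μ (ofPair s).2), ?_, ?_⟩
  · rw [hgraph]
    refine ⟨ofPair s, (hT _).2 fun x => ?_, rfl⟩
    obtain ⟨v, hv⟩ := hs x
    rw [pairAt_ofPair, hv]
    exact hQmem x v
  · refine lt_of_le_of_lt ?_ (half_lt_self hε)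
    rw [Prod.dist_eq, max_le_iff]
    refine ⟨dist_toL2_le (half_pos hε).le ((eLpNorm_mono fun x => ?_).trans hsε),
      dist_toL2_le (half_pos hε).le ((eLpNorm_mono fun x => ?_).trans hsε)⟩
    · exact WithLp.norm_fst_le (p := 2) (x := lpPair f g x - s x)
    · exact WithLp.norm_snd_le (p := 2) (x := lpPair f g x - s x)

end FiberwiseGraph

/-! ### Faithfulness of the multiplication representation -/

section Representation

variable {X : Type v} [TopologicalSpace X] [MeasurableSpace X] [BorelSpace X]
variable {K : Type u} [NormedAddCommGroup K] [InnerProductSpace ℂ K] [CompleteSpace K]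
variable {μ : Measure X} [IsFiniteMeasure μ] [μ.IsOpenPosMeasure]

/-- The constant function v is square integrable because `μ` is finite, and a·v = 0 almost
everywhere forces the continuous function a to vanish. -/
theorem mulRep_injective {v : K} (hv : v ≠ 0) : Function.Injective (mulRep K μ) := by
  rw [injective_iff_map_eq_zero]
  intro a ha
  let c : Lp K 2 μ := (memLp_const v).toLp _
  have h1 := mulOp_coeFn K μ a c
  have h0 : mulOp K μ a c = 0 := congrArg (fun L : Lp K 2 μ →L[ℂ] Lp K 2 μ => L c) ha
  rw [h0] at h1
  have h2 : (a : X → ℂ) =ᵐ[μ] (0 : C₀(X, ℂ)) := by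
    filter_upwards [h1, Lp.coeFn_zero K 2 μ, (memLp_const (μ := μ) (p := 2) v).coeFn_toLp]
      with x hx hx0 hxc
    have hxc' : c x = v := hxc
    rw [hx0, hxc'] at hx
    exact (smul_eq_zero.1 hx.symm).resolve_right hv
  ext x
  exact congrFun ((map_continuous a).ae_eq_iff_eq μ (map_continuous (0 : C₀(X, ℂ))) |>.1 h2) x

end Representation

/-! ### The localizations of `T_max` and `T_Λ`: domain and selfadjointness -/

section LocalizedOperators

variable {X : Type v} [TopologicalSpace X] [MeasurableSpace X] [BorelSpace X]
  [T2Space X] [LocallyCompactSpace X]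
variable {H : Type u} [NormedAddCommGroup H] [InnerProductSpace ℂ H] [CompleteSpace H]
  [TopologicalSpace.SeparableSpace H] (B : DeficiencyOne H)
variable {μ : Measure X} [IsFiniteMeasure μ] [μ.Regular] [μ.IsOpenPosMeasure]

theorem mem_graph_localize_Tmax_iff {f g : Lp H 2 μ} : (f, g) ∈ (localize μ (Tmax B X)).graph ↔
    ∀ᵐ x ∂μ, lpPair f g x ∈ l2Graph B.Dmax :=
  mem_graph_localize_iff (fun _ => mem_Tmax_graph B) (fun _ => isClosed_l2Graph B.isClosed_Dmax)
    (fun _ _ hq h0 => LinearPMap.graph_fst_eq_zero_snd _ (mem_l2Graph.1 hq) h0) isOpen_univ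
    (by simp) (Q := fun _ => (l2Graph B.Dmax).starProjection) continuousOn_const
    (fun _ => (l2Graph B.Dmax).starProjection_norm_le.trans one_le_two)
    (fun _ v => Submodule.starProjection_apply_mem _ v)
    (fun _ _ hv => Submodule.starProjection_eq_self_iff.2 hv)

variable {Λ : X → Circle}

theorem mem_graph_localize_TLam_iff (hμ : μ (reg Λ)ᶜ = 0) {f g : Lp H 2 μ} :
    (f, g) ∈ (localize μ (TLam B Λ)).graph ↔ ∀ᵐ x ∂μ, lpPair f g x ∈ B.extGraph (Λ x) :=
  mem_graph_localize_iff (fun _ => mem_TLam_graph B) (fun _ => B.isClosed_extGraph _)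
    (fun _ _ hq h0 => LinearPMap.graph_fst_eq_zero_snd _ (mem_l2Graph.1 hq) h0) (isOpen_reg Λ)
    hμ (Q := fun x => B.extProj (Λ x)) (B.continuous_extProj.comp_continuousOn (continuousOn_reg Λ))
    (fun _ => B.norm_extProj_le _) (fun _ v => B.extProj_mem _ v)
    (fun _ _ hv => B.extProj_eq_self hv)

theorem dense_domain_localize_TLam (hμ : μ (reg Λ)ᶜ = 0) :
    Dense ((localize μ (TLam B Λ)).domain : Set (Lp H 2 μ)) := by
  refine ((denseRange_toL2 μ).dense_image continuous_toL2 (dense_domain_TLam B Λ)).mono ?_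
  rintro - ⟨f, hf, rfl⟩
  obtain ⟨g, hg⟩ := LinearPMap.mem_domain_iff.1 hf
  refine LinearPMap.mem_domain_iff.2 ⟨toL2 H μ g, (mem_graph_localize_TLam_iff B hμ).2 ?_⟩
  filter_upwards [coeFn_toL2 (μ := μ) f, coeFn_toL2 (μ := μ) g] with x hxf hxg
  rw [lpPair, hxf, hxg]
  exact (mem_TLam_graph B).1 hg x

omit [TopologicalSpace.SeparableSpace H] in
theorem mem_domain_ext_iff {l : Circle} {p : WithLp 2 (H × H)} (hp : p ∈ l2Graph B.Dmax) :
    p.fst ∈ (B.ext l).domain ↔ p ∈ B.extGraph l := by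
  constructor
  · intro h
    obtain ⟨b, hb⟩ := LinearPMap.mem_domain_iff.1 h
    have hb' : WithLp.toLp 2 (p.fst, b) ∈ B.extGraph l := hb
    have he : p.snd = b :=
      LinearPMap.mem_graph_snd_inj _ (mem_l2Graph.1 hp) (B.extGraph_le l hb') rfl
    rw [← he] at hb'
    exact hb'
  · exact fun h => LinearPMap.mem_domain_of_mem_graph (mem_l2Graph.1 h)

theorem mem_domain_localize_TLam_iff (hμ : μ (reg Λ)ᶜ = 0) (f : Lp H 2 μ) :
    f ∈ (localize μ (TLam B Λ)).domain ↔
      f ∈ (localize μ (Tmax B X)).domain ∧ ∀ᵐ x ∂μ, f x ∈ (B.ext (Λ x)).domain := by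
  constructor
  · intro h
    obtain ⟨g, hg⟩ := LinearPMap.mem_domain_iff.1 h
    rw [mem_graph_localize_TLam_iff B hμ] at hg
    refine ⟨LinearPMap.mem_domain_iff.2 ⟨g, (mem_graph_localize_Tmax_iff B).2 ?_⟩, ?_⟩
    · exact hg.mono fun x hx => B.extGraph_le _ hx
    · exact hg.mono fun x hx => (mem_domain_ext_iff B (B.extGraph_le _ hx)).2 hx
  · rintro ⟨h, hd⟩
    obtain ⟨g, hg⟩ := LinearPMap.mem_domain_iff.1 h
    refine LinearPMap.mem_domain_iff.2 ⟨g, (mem_graph_localize_TLam_iff B hμ).2 ?_⟩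
    filter_upwards [(mem_graph_localize_Tmax_iff B).1 hg, hd] with x hx hxd
    exact (mem_domain_ext_iff B hx).1 hxd

theorem lpPair_apply_mem (f : (localize μ (Tmax B X)).domain) :
    ∀ᵐ x ∂μ, lpPair (f : Lp H 2 μ) (localize μ (Tmax B X) f) x ∈ l2Graph B.Dmax :=
  (mem_graph_localize_Tmax_iff B).1 (LinearPMap.mem_graph _ f)

omit [TopologicalSpace X] [BorelSpace X] [T2Space X] [LocallyCompactSpace X]
  [TopologicalSpace.SeparableSpace H] in
-- The normal vector stays in the span of two fixed vectors, so only the scalar coefficient conj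
-- Λ(x) has to be measurable.
theorem stronglyMeasurable_etaVec (hΛ : Measurable fun x => (Λ x : ℂ)) :
    StronglyMeasurable fun x => B.etaVec (Λ x) := by
  have h : StronglyMeasurable fun x => starRingEnd ℂ (Λ x : ℂ) • B.vm :=
    (Complex.continuous_conj.measurable.comp hΛ).stronglyMeasurable.smul_const _
  exact ((stronglyMeasurable_const (b := B.vp)).sub h).const_smul (((√2 : ℝ) : ℂ)⁻¹)

omit [μ.Regular] [μ.IsOpenPosMeasure] in
omit [TopologicalSpace X] [BorelSpace X] [T2Space X] [LocallyCompactSpace X]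
  [TopologicalSpace.SeparableSpace H] in
theorem memLp_etaVec (hΛ : Measurable fun x => (Λ x : ℂ)) :
    MemLp (fun x => B.etaVec (Λ x)) 2 μ :=
  MemLp.of_bound (stronglyMeasurable_etaVec B hΛ).aestronglyMeasurable 1
    (Eventually.of_forall fun _ => (B.norm_etaVec _).le)

/-- The normal field has norm 1 in every fibre, hence is square integrable and a section of the
graph of `D^*`. Orthogonality to it in the graph product is the boundary condition. -/
theorem exists_eta (hΛ : Measurable fun x => (Λ x : ℂ)) (hμ : μ (reg Λ)ᶜ = 0) :
    ∃ η : (localize μ (Tmax B X)).domain,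
      ((η : Lp H 2 μ) : X → H) =ᵐ[μ] (fun x => (B.etaPerp (Λ x) : H)) ∧
      ∀ f : Lp H 2 μ, f ∈ (localize μ (TLam B Λ)).domain ↔
        ∃ hf : f ∈ (localize μ (Tmax B X)).domain,
          ∀ᵐ x ∂μ, fiberGraphInner (localize μ (Tmax B X)) ⟨f, hf⟩ η x = 0 := by
  have h1 : MemLp (fun x => (B.etaVec (Λ x)).fst) 2 μ :=
    (WithLp.fstL 2 ℂ H H).comp_memLp' (memLp_etaVec B hΛ)
  have h2 : MemLp (fun x => (B.etaVec (Λ x)).snd) 2 μ :=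
    (WithLp.sndL 2 ℂ H H).comp_memLp' (memLp_etaVec B hΛ)
  have hmem : (h1.toLp, h2.toLp) ∈ (localize μ (Tmax B X)).graph := by
    rw [mem_graph_localize_Tmax_iff]
    filter_upwards [h1.coeFn_toLp, h2.coeFn_toLp] with x hx1 hx2
    rw [lpPair, hx1, hx2]
    exact B.etaVec_mem (Λ x)
  obtain ⟨η, hη1, hη2⟩ := (LinearPMap.mem_graph_iff _).1 hmem
  dsimp only at hη1 hη2
  have key : ∀ᵐ x ∂μ, lpPair (η : Lp H 2 μ) (localize μ (Tmax B X) η) x = B.etaVec (Λ x) := by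
    filter_upwards [h1.coeFn_toLp, h2.coeFn_toLp] with x hx1 hx2
    rw [lpPair, hη1, hη2, hx1, hx2]
    rfl
  refine ⟨η, ?_, fun f => ?_⟩
  · filter_upwards [key] with x hx
    have h := congrArg WithLp.fst (hx.trans (B.graphVec_etaPerp (Λ x)).symm)
    exact h
  · have hinner : ∀ hf : f ∈ (localize μ (Tmax B X)).domain, ∀ᵐ x ∂μ,
        (fiberGraphInner (localize μ (Tmax B X)) ⟨f, hf⟩ η x = 0 ↔
          f x ∈ (B.ext (Λ x)).domain) := by
      intro hf
      filter_upwards [key, lpPair_apply_mem B ⟨f, hf⟩] with x hx hfx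
      have e : fiberGraphInner (localize μ (Tmax B X)) ⟨f, hf⟩ η x =
          inner ℂ (lpPair f (localize μ (Tmax B X) ⟨f, hf⟩) x)
            (lpPair (η : Lp H 2 μ) (localize μ (Tmax B X) η) x) := rfl
      rw [e, hx, inner_eq_zero_symm, B.inner_etaVec_eq_zero_iff]
      have hfx' := mem_domain_ext_iff B (l := Λ x) hfx
      rw [B.mem_extGraph, and_iff_right hfx] at hfx'
      exact hfx'.symm
    rw [mem_domain_localize_TLam_iff B hμ]
    constructor
    · rintro ⟨hf, h⟩
      refine ⟨hf, ?_⟩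
      filter_upwards [hinner hf, h] with x hx1 hx2 using hx1.2 hx2
    · rintro ⟨hf, h⟩
      refine ⟨hf, ?_⟩
      filter_upwards [hinner hf, h] with x hx1 hx2 using hx1.1 hx2

omit [TopologicalSpace.SeparableSpace H] in
theorem inner_extProj (l : Circle) (p q : WithLp 2 (H × H)) :
    inner ℂ (B.extProj l p) q = inner ℂ p (B.extProj l q) := by
  rw [B.extProj_apply, B.extProj_apply, inner_sub_left, inner_sub_right,
    Submodule.inner_starProjection_left_eq_right, inner_smul_left, inner_smul_right,
    inner_conj_symm, mul_comm]

omit [IsFiniteMeasure μ] [μ.Regular] [μ.IsOpenPosMeasure] in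
omit [TopologicalSpace X] [BorelSpace X] [T2Space X] [LocallyCompactSpace X]
  [TopologicalSpace.SeparableSpace H] in
theorem memLp_extProj (hΛ : Measurable fun x => (Λ x : ℂ)) {F : X → WithLp 2 (H × H)}
    (hF : MemLp F 2 μ) : MemLp (fun x => B.extProj (Λ x) (F x)) 2 μ := by
  have hη := (stronglyMeasurable_etaVec B hΛ).aestronglyMeasurable (μ := μ)
  refine MemLp.of_le_mul (c := 2) hF ?_ (Eventually.of_forall fun x => ?_)
  · simp only [B.extProj_apply]
    exact ((l2Graph B.Dmax).starProjection.continuous.comp_aestronglyMeasurable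
      hF.aestronglyMeasurable).sub ((hη.inner (𝕜 := ℂ) hF.aestronglyMeasurable).smul hη)
  · exact ((B.extProj (Λ x)).le_opNorm _).trans
      (mul_le_mul_of_nonneg_right (B.norm_extProj_le _) (norm_nonneg _))

omit [TopologicalSpace X] [BorelSpace X] [T2Space X] [LocallyCompactSpace X] [CompleteSpace H]
  [TopologicalSpace.SeparableSpace H] [IsFiniteMeasure μ] [μ.Regular] [μ.IsOpenPosMeasure] in
theorem inner_sub_inner_eq_integral (y z a b : Lp H 2 μ) :
    inner ℂ y b - inner ℂ z a = ∫ x, (inner ℂ (y x) (b x) - inner ℂ (z x) (a x) : ℂ) ∂μ := by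
  rw [L2.inner_def, L2.inner_def, integral_sub (L2.integrable_inner y b) (L2.integrable_inner z a)]

/-- The localization of `T_Λ` is selfadjoint. -/
theorem adjoint_localize_TLam (hΛ : Measurable fun x => (Λ x : ℂ)) (hμ : μ (reg Λ)ᶜ = 0) :
    (localize μ (TLam B Λ)).adjoint = localize μ (TLam B Λ) := by
  refine LinearPMap.eq_of_eq_graph ?_
  ext ⟨y, z⟩
  rw [mem_graph_adjoint_iff (dense_domain_localize_TLam B hμ), mem_graph_localize_TLam_iff B hμ]
  constructor
  · intro h
    -- Membership of (y, z) in the adjoint graph means that (-z, y) is orthogonal to the localized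
    -- graph. The test element is the fibrewise projection u of (-z, y).
    have hm : MemLp (lpPair (-z) y) 2 μ := memLp_lpPair (-z) y
    have hu := memLp_extProj B hΛ hm
    have hu1 : MemLp (fun x => (B.extProj (Λ x) (lpPair (-z) y x)).fst) 2 μ :=
      (WithLp.fstL 2 ℂ H H).comp_memLp' hu
    have hu2 : MemLp (fun x => (B.extProj (Λ x) (lpPair (-z) y x)).snd) 2 μ :=
      (WithLp.sndL 2 ℂ H H).comp_memLp' hu
    have hmem : (hu1.toLp, hu2.toLp) ∈ (localize μ (TLam B Λ)).graph := by
      rw [mem_graph_localize_TLam_iff B hμ]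
      filter_upwards [hu1.coeFn_toLp, hu2.coeFn_toLp] with x hx1 hx2
      rw [lpPair, hx1, hx2]
      exact B.extProj_mem _ _
    have h0 := sub_eq_zero.2 (h _ _ hmem)
    rw [inner_sub_inner_eq_integral] at h0
    -- As the projections are symmetric and idempotent, the test gives 0 = ⟨(-z, y), u⟩ = ‖u‖². So
    -- (-z, y) is orthogonal to almost every fibre graph, and selfadjointness of `D_{Λ(x)}`
    -- concludes.
    have hself : inner ℂ (hu.toLp) (hu.toLp) = (0 : ℂ) := by
      rw [L2.inner_def, ← h0]
      refine integral_congr_ae ?_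
      filter_upwards [hu.coeFn_toLp, hu1.coeFn_toLp, hu2.coeFn_toLp, Lp.coeFn_neg z]
        with x hx hx1 hx2 hz
      rw [hx, hx1, hx2, inner_extProj, B.extProj_eq_self (B.extProj_mem _ _), l2_inner]
      change inner ℂ ((-z : Lp H 2 μ) x) _ + inner ℂ (y x) _ = _
      rw [hz, Pi.neg_apply, inner_neg_left]
      ring
    rw [inner_self_eq_zero] at hself
    have hae : (hu.toLp : X → WithLp 2 (H × H)) =ᵐ[μ] 0 := by
      rw [hself]; exact Lp.coeFn_zero _ _ _
    filter_upwards [hae, hu.coeFn_toLp, Lp.coeFn_neg z] with x hx0 hx hz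
    rw [hx] at hx0
    rw [B.mem_extGraph_iff_forall]
    intro q hq
    have h1 : inner ℂ (lpPair (-z) y x) q = (0 : ℂ) := by
      rw [← B.extProj_eq_self hq, ← inner_extProj, hx0, Pi.zero_apply, inner_zero_left]
    rw [l2_inner] at h1
    change inner ℂ ((-z : Lp H 2 μ) x) _ + inner ℂ (y x) _ = (0 : ℂ) at h1
    rw [hz, Pi.neg_apply, inner_neg_left] at h1
    change inner ℂ (y x) q.snd = inner ℂ (z x) q.fst
    linear_combination h1
  · intro h a b hab
    rw [mem_graph_localize_TLam_iff B hμ] at hab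
    rw [L2.inner_def, L2.inner_def]
    refine integral_congr_ae ?_
    filter_upwards [h, hab] with x hx hxab
    exact B.mem_extGraph_iff_forall.1 hx _ hxab

end LocalizedOperators

/-! ### Operators with deficiency indices (1,1) from a bounded selfadjoint injection -/

section RestrictedInverse

variable {H : Type u} [NormedAddCommGroup H] [InnerProductSpace ℂ H]

theorem exists_normalized_eigenvector {T : H →ₗ.[ℂ] H} {z : ℂ} (hz : ‖z‖ = 1)
    (h : Module.finrank ℂ (eigenspace T z) = 1) :
    ∃ φ : T.domain, T φ = z • (φ : H) ∧ graphInner T φ φ = 1 := by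
  obtain ⟨⟨v, hv⟩, hv0, -⟩ := finrank_eq_one_iff'.1 h
  have hv0' : v ≠ 0 := fun e => hv0 (Subtype.ext e)
  have hn : ‖v‖ ≠ 0 := norm_ne_zero_iff.2 hv0'
  have hw := (eigenspace T z).smul_mem (((‖v‖ * √2)⁻¹ : ℝ) : ℂ) hv
  set w := (((‖v‖ * √2)⁻¹ : ℝ) : ℂ) • v with hwdef
  obtain ⟨φ, h1, h2⟩ := (LinearPMap.mem_graph_iff _).1 (show (w, z • w) ∈ T.graph from hw)
  dsimp only at h1 h2
  have h3 : T φ = z • (φ : H) := by rw [h2, h1]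
  refine ⟨φ, h3, ?_⟩
  have hnw : ‖w‖ ^ 2 = 1 / 2 := by
    rw [hwdef, norm_smul, Complex.norm_real, Real.norm_of_nonneg (by positivity), mul_inv, mul_pow,
      mul_pow, inv_pow, inv_pow, Real.sq_sqrt zero_le_two]
    field_simp
  rw [graphInner, h3, inner_self_eq_norm_sq_to_K, inner_self_eq_norm_sq_to_K, norm_smul, hz,
    one_mul, h1]
  have : ((‖w‖ : ℝ) : ℂ) ^ 2 = 1 / 2 := by
    rw [← Complex.ofReal_pow, hnw]; norm_num
  change ((‖w‖ : ℝ) : ℂ) ^ 2 + ((‖w‖ : ℝ) : ℂ) ^ 2 = 1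
  rw [this]; norm_num

/-- The graph of the restriction of `R⁻¹` to the image under `R` of the orthogonal complement
of `w`. -/
def restrictedInverseGraph (R : H →L[ℂ] H) (w : H) : Submodule ℂ (H × H) where
  carrier := {p | p.1 = R p.2 ∧ inner ℂ w p.2 = 0}
  add_mem' := by
    rintro p q ⟨h1, h2⟩ ⟨h3, h4⟩
    refine ⟨?_, ?_⟩
    · rw [Prod.fst_add, Prod.snd_add, map_add, h1, h3]
    · rw [Prod.snd_add, inner_add_right, h2, h4, add_zero]
  zero_mem' := ⟨(map_zero R).symm, inner_zero_right _⟩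
  smul_mem' := by
    rintro c p ⟨h1, h2⟩
    refine ⟨?_, ?_⟩
    · rw [Prod.smul_fst, Prod.smul_snd, map_smul, h1]
    · rw [Prod.smul_snd, inner_smul_right, h2, mul_zero]

/-- The restriction of `R⁻¹` to the image under `R` of the orthogonal complement of `w`. -/
def restrictedInverse (R : H →L[ℂ] H) (w : H) : H →ₗ.[ℂ] H :=
  (restrictedInverseGraph R w).toLinearPMap

variable {R : H →L[ℂ] H} {w : H}

theorem mem_graph_restrictedInverse (hinj : Function.Injective R) {a b : H} :
    (a, b) ∈ (restrictedInverse R w).graph ↔ a = R b ∧ inner ℂ w b = 0 := by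
  rw [restrictedInverse, Submodule.toLinearPMap_graph_eq]
  · rfl
  · rintro p ⟨h1, -⟩ h0
    refine hinj ?_
    rw [← h1, h0, map_zero]

theorem isClosed_restrictedInverse (hinj : Function.Injective R) :
    (restrictedInverse R w).IsClosed := by
  have : ((restrictedInverse R w).graph : Set (H × H)) =
      {p | p.1 = R p.2} ∩ {p | inner ℂ w p.2 = 0} := by
    ext ⟨a, b⟩
    exact mem_graph_restrictedInverse hinj
  rw [LinearPMap.IsClosed, this]
  exact (isClosed_eq continuous_fst (R.continuous.comp continuous_snd)).inter
    (isClosed_eq (continuous_const.inner continuous_snd) continuous_const)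

theorem mem_span_of_orthogonal {w y : H}
    (h : ∀ b, inner ℂ w b = 0 → inner ℂ y b = 0) : ∃ c : ℂ, c • w = y := by
  refine Submodule.mem_span_singleton.1 ?_
  rw [← Submodule.orthogonal_orthogonal (Submodule.span ℂ {w}), Submodule.mem_orthogonal']
  exact fun b hb => h b (Submodule.mem_orthogonal_singleton_iff_inner_right.1 hb)

variable [CompleteSpace H]

/-- If y is orthogonal to R(w^⊥), then Ry is a multiple of w. Since w is not in the range of R, the
multiple is 0, and injectivity gives y = 0. -/
theorem dense_domain_restrictedInverse (hinj : Function.Injective R) (hR : IsSelfAdjoint R)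
    (hw : w ∉ Set.range R) : Dense ((restrictedInverse R w).domain : Set H) := by
  rw [Submodule.dense_iff_topologicalClosure_eq_top, Submodule.topologicalClosure_eq_top_iff,
    Submodule.eq_bot_iff]
  intro y hy
  obtain ⟨c, hc⟩ := mem_span_of_orthogonal (w := w) (y := R y) fun b hb => by
    rw [show inner ℂ (R y) b = inner ℂ y (R b) from hR.isSymmetric y b]
    refine (Submodule.mem_orthogonal' _ _).1 hy _ (LinearPMap.mem_domain_iff.2 ⟨b, ?_⟩)
    exact (mem_graph_restrictedInverse hinj).2 ⟨rfl, hb⟩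
  have hc0 : c = 0 := by
    by_contra hne
    refine hw ⟨c⁻¹ • y, ?_⟩
    rw [map_smul, ← hc, smul_smul, inv_mul_cancel₀ hne, one_smul]
  refine hinj ?_
  rw [← hc, hc0, zero_smul, map_zero]

theorem restrictedInverse_le_adjoint (hinj : Function.Injective R) (hR : IsSelfAdjoint R)
    (hw : w ∉ Set.range R) : restrictedInverse R w ≤ (restrictedInverse R w).adjoint := by
  refine LinearPMap.le_of_le_graph ?_
  rintro ⟨y, z⟩ hyz
  rw [mem_graph_adjoint_iff (dense_domain_restrictedInverse hinj hR hw)]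
  intro a b hab
  rw [mem_graph_restrictedInverse hinj] at hyz hab
  rw [hyz.1, hab.1]
  exact hR.isSymmetric z b

theorem mem_graph_adjoint_restrictedInverse (hinj : Function.Injective R) (hR : IsSelfAdjoint R)
    (hw : w ∉ Set.range R) {y z : H} :
    (y, z) ∈ (restrictedInverse R w).adjoint.graph ↔ ∃ c : ℂ, c • w = y - R z := by
  rw [mem_graph_adjoint_iff (dense_domain_restrictedInverse hinj hR hw)]
  constructor
  · intro h
    refine mem_span_of_orthogonal fun b hb => ?_
    rw [inner_sub_left, h (R b) b ((mem_graph_restrictedInverse hinj).2 ⟨rfl, hb⟩), sub_eq_zero]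
    exact (hR.isSymmetric z b).symm
  · rintro ⟨c, hc⟩ a b hab
    rw [mem_graph_restrictedInverse hinj] at hab
    have h1 : inner ℂ (y - R z) b = 0 := by rw [← hc, inner_smul_left, hab.2, mul_zero]
    rw [inner_sub_left, sub_eq_zero] at h1
    rw [h1, hab.1]
    exact hR.isSymmetric z b

/-- By the description of the adjoint graph, y is an eigenvector for z iff (z⁻¹ - R)y is a multiple
of w. For nonreal z the operator z⁻¹ - R is invertible because R has real spectrum, so the
eigenspace is the line through the preimage of w. -/
theorem finrank_eigenspace_adjoint (hinj : Function.Injective R) (hR : IsSelfAdjoint R)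
    (hw : w ∉ Set.range R) {z : ℂ} (hz : z.im ≠ 0) :
    Module.finrank ℂ (eigenspace (restrictedInverse R w).adjoint z) = 1 := by
  have hz0 : z ≠ 0 := fun h => hz (by rw [h, Complex.zero_im])
  have hunit : IsUnit (algebraMap ℂ (H →L[ℂ] H) z⁻¹ - R) := by
    rw [← spectrum.notMem_iff]
    intro h
    have h1 := hR.im_eq_zero_of_mem_spectrum h
    rw [Complex.inv_im, div_eq_zero_iff, neg_eq_zero] at h1
    exact h1.elim hz fun h2 => hz0 (Complex.normSq_eq_zero.1 h2)
  obtain ⟨hi, hs⟩ := ContinuousLinearMap.isUnit_iff_bijective.1 hunit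
  obtain ⟨v, hv⟩ := hs w
  have hw0 : w ≠ 0 := fun h => hw ⟨0, by rw [map_zero, h]⟩
  have hv0 : v ≠ 0 := fun h => hw0 (by rw [← hv, h, map_zero])
  have hA : ∀ y, (algebraMap ℂ (H →L[ℂ] H) z⁻¹ - R) y = z⁻¹ • (y - R (z • y)) := by
    intro y
    rw [map_smul, smul_sub, smul_smul, inv_mul_cancel₀ hz0, one_smul, Algebra.algebraMap_eq_smul_one]
    rfl
  have heq : eigenspace (restrictedInverse R w).adjoint z = Submodule.span ℂ {v} := by
    ext y
    have h1 : y ∈ eigenspace (restrictedInverse R w).adjoint z ↔ ∃ c : ℂ, c • w = y - R (z • y) :=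
      mem_graph_adjoint_restrictedInverse hinj hR hw
    rw [h1, Submodule.mem_span_singleton]
    constructor
    · rintro ⟨c, hc⟩
      refine ⟨z⁻¹ * c, hi ?_⟩
      rw [map_smul, hv, hA, ← hc, smul_smul]
    · rintro ⟨c, rfl⟩
      refine ⟨z * c, ?_⟩
      have h2 := hA (c • v)
      rw [map_smul, hv] at h2
      rw [mul_smul, h2, smul_smul, mul_inv_cancel₀ hz0, one_smul]
  rw [heq, finrank_span_singleton hv0]

theorem exists_deficiencyOne (hinj : Function.Injective R) (hR : IsSelfAdjoint R)
    (hw : w ∉ Set.range R) : Nonempty (DeficiencyOne H) := by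
  have hp := finrank_eigenspace_adjoint hinj hR hw (z := Complex.I) (by simp)
  have hm := finrank_eigenspace_adjoint hinj hR hw (z := -Complex.I) (by simp)
  obtain ⟨φp, hp1, hp2⟩ := exists_normalized_eigenvector (by simp) hp
  obtain ⟨φm, hm1, hm2⟩ := exists_normalized_eigenvector (by simp) hm
  exact ⟨{
    D := restrictedInverse R w
    dense_domain := dense_domain_restrictedInverse hinj hR hw
    closed := isClosed_restrictedInverse hinj
    symmetric := restrictedInverse_le_adjoint hinj hR hw
    deficiency_plus := hp
    deficiency_minus := hm
    φp := φp
    φm := φm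
    apply_φp := hp1
    apply_φm := hm1
    norm_φp := hp2
    norm_φm := hm2 }⟩

end RestrictedInverse

/-! ### Examples on [0,1]: multiplication by the coordinate, a jump and a removable singularity -/

section UnitInterval

instance isOpenPosMeasure_unitInterval : (volume : Measure unitInterval).IsOpenPosMeasure where
  open_pos U hU hne := by
    obtain ⟨V, hV, rfl⟩ := isOpen_induced_iff.1 hU
    obtain ⟨x, hx⟩ := hne
    have hx' : (x : ℝ) ∈ closure (Set.Ioo (0 : ℝ) 1) := by
      rw [closure_Ioo zero_ne_one]; exact x.2
    have hne' : (V ∩ Set.Ioo (0 : ℝ) 1).Nonempty := mem_closure_iff.1 hx' V hV hx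
    have hpos := (hV.inter isOpen_Ioo).measure_pos volume hne'
    have hsub : V ∩ Set.Ioo (0 : ℝ) 1 ⊆
        ((↑) : unitInterval → ℝ) '' (((↑) : unitInterval → ℝ) ⁻¹' V) := fun y hy =>
      ⟨⟨y, hy.2.1.le, hy.2.2.le⟩, hy.1, rfl⟩
    have h := hpos.trans_le (measure_mono hsub)
    rw [Measure.Subtype.volume_def, comap_subtype_coe_apply measurableSet_Icc]
    exact h.ne'

/-- The coordinate function on `[0, 1]`. -/
def coordC0 : C₀(unitInterval, ℂ) where
  toFun x := ((x : ℝ) : ℂ)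
  continuous_toFun := by fun_prop
  zero_at_infty' := by simp

/-- Multiplication by the coordinate on `L²[0, 1]`. -/
def mulCoord : Lp ℂ 2 (volume : Measure unitInterval) →L[ℂ] Lp ℂ 2 (volume : Measure unitInterval) :=
  mulRep ℂ volume coordC0

theorem mulCoord_coeFn (f : Lp ℂ 2 (volume : Measure unitInterval)) :
    (mulCoord f : unitInterval → ℂ) =ᵐ[volume] fun x => ((x : ℝ) : ℂ) • f x :=
  mulOp_coeFn ℂ volume coordC0 f

theorem isSelfAdjoint_mulCoord : IsSelfAdjoint mulCoord := by
  have h : star coordC0 = coordC0 := by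
    ext x
    exact Complex.conj_ofReal _
  rw [IsSelfAdjoint, mulCoord, ← map_star, h]

theorem mulCoord_injective : Function.Injective mulCoord := by
  rw [injective_iff_map_eq_zero]
  intro f hf
  have h1 := mulCoord_coeFn f
  rw [hf] at h1
  refine Lp.ext ?_
  have h0 : ∀ᵐ x : unitInterval, x ≠ 0 := compl_mem_ae_iff.2 (measure_singleton 0)
  filter_upwards [h1, h0, Lp.coeFn_zero ℂ 2 (volume : Measure unitInterval)] with x hx hx0 hz
  rw [hz] at hx ⊢
  refine (smul_eq_zero.1 hx.symm).resolve_left fun h => hx0 ?_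
  exact Subtype.ext (Complex.ofReal_eq_zero.1 h)

theorem mulCoord_not_surjective : ¬ Function.Surjective mulCoord := by
  intro hs
  obtain ⟨C, hC, h⟩ := mulCoord.exists_preimage_norm_le hs
  -- Surjectivity and injectivity would give ‖f‖ ≤ C‖xf‖. On functions supported where x < 1/(2C)
  -- the right side is at most ‖f‖/2.
  let S : Set unitInterval := {x | (x : ℝ) < (2 * C)⁻¹}
  have hSo : IsOpen S := isOpen_lt continuous_subtype_val continuous_const
  have hS0 : (volume : Measure unitInterval) S ≠ 0 :=
    (hSo.measure_pos volume ⟨0, by change (0 : ℝ) < _; positivity⟩).ne'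
  let f := indicatorConstLp 2 hSo.measurableSet (measure_ne_top volume S) (1 : ℂ)
  have hf : 0 < ‖f‖ := by
    rw [norm_indicatorConstLp (by norm_num) (by norm_num), norm_one, one_mul]
    exact Real.rpow_pos_of_pos (ENNReal.toReal_pos hS0 (measure_ne_top _ _)) _
  have hle : ‖mulCoord f‖ ≤ (2 * C)⁻¹ * ‖f‖ := by
    refine Lp.norm_le_mul_norm_of_ae_le_mul ?_
    filter_upwards [mulCoord_coeFn f, indicatorConstLp_coeFn (hs := hSo.measurableSet)
      (hμs := measure_ne_top volume S) (c := (1 : ℂ)) (p := 2)] with x hx hxf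
    rw [hx, norm_smul]
    by_cases hxS : x ∈ S
    · refine mul_le_mul_of_nonneg_right ?_ (norm_nonneg _)
      rw [Complex.norm_real, Real.norm_of_nonneg x.2.1]
      exact hxS.le
    · have : f x = 0 := hxf.trans (Set.indicator_of_notMem hxS _)
      rw [this, norm_zero, mul_zero, mul_zero]
  obtain ⟨g, hg, hgn⟩ := h (mulCoord f)
  rw [mulCoord_injective hg] at hgn
  have : C * ((2 * C)⁻¹ * ‖f‖) = ‖f‖ / 2 := by field_simp
  have h3 := hgn.trans (mul_le_mul_of_nonneg_left hle hC.le)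
  rw [this] at h3
  linarith

theorem nonempty_deficiencyOne_L2 :
    Nonempty (DeficiencyOne (Lp ℂ 2 (volume : Measure unitInterval))) := by
  obtain ⟨w, hw⟩ := not_forall.1 mulCoord_not_surjective
  exact exists_deficiencyOne mulCoord_injective isSelfAdjoint_mulCoord hw

theorem separableSpace_L2 :
    TopologicalSpace.SeparableSpace (Lp ℂ 2 (volume : Measure unitInterval)) := by
  have : Fact ((2 : ℝ≥0∞) ≠ ∞) := ⟨by norm_num⟩
  have := Lp.SecondCountableTopology (E := ℂ) (μ := (volume : Measure unitInterval)) (p := 2)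
  infer_instance

/-- The midpoint of `[0, 1]`. -/
def mid : unitInterval := ⟨1 / 2, by norm_num, by norm_num⟩

instance : (𝓝[<] mid).NeBot :=
  nhdsLT_neBot_of_exists_lt ⟨0, by change (0 : ℝ) < 1 / 2; norm_num⟩

instance : (𝓝[>] mid).NeBot :=
  nhdsGT_neBot_of_exists_gt ⟨1, by change (1 / 2 : ℝ) < 1; norm_num⟩

instance : (𝓝[≠] mid).NeBot :=
  NeBot.mono (f := 𝓝[<] mid) inferInstance (nhdsWithin_mono _ fun _ hx => ne_of_lt hx)

/-- A circle-valued function with a jump in the midpoint. -/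
def jump (x : unitInterval) : Circle := if x < mid then 1 else -1

/-- A circle-valued function with a removable discontinuity in the midpoint. -/
def removable (x : unitInterval) : Circle := if x = mid then -1 else 1

theorem reg_eq_compl_mid {Λ : unitInterval → Circle} (h : ContinuousOn Λ {mid}ᶜ)
    (hm : mid ∉ reg Λ) : reg Λ = {mid}ᶜ := by
  refine Set.Subset.antisymm (fun x hx hxm => hm ?_) fun x hx =>
    ⟨_, isOpen_compl_singleton, hx, h⟩
  rwa [← Set.mem_singleton_iff.1 hxm]

theorem closure_compl_mid : closure ({mid}ᶜ : Set unitInterval) = Set.univ :=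
  closure_compl_singleton mid

theorem frontier_compl_mid : frontier ({mid}ᶜ : Set unitInterval) = {mid} := by
  rw [frontier_compl, frontier, closure_singleton, interior_singleton, Set.sdiff_empty]

theorem one_ne_neg_one_circle : (1 : Circle) ≠ -1 := fun h => Circle.neg_ne_self 1 h.symm

theorem jump_eventually_left : ∀ᶠ x in 𝓝[<] mid, jump x = 1 := by
  filter_upwards [self_mem_nhdsWithin] with x hx using if_pos hx

theorem jump_eventually_right : ∀ᶠ x in 𝓝[>] mid, jump x = -1 := by
  filter_upwards [self_mem_nhdsWithin] with x hx using if_neg (not_lt.2 (le_of_lt hx))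

theorem removable_eventually : ∀ᶠ x in 𝓝[≠] mid, removable x = 1 := by
  filter_upwards [self_mem_nhdsWithin] with x hx using if_neg hx

/-- No continuous function agrees with the jump function near the midpoint. -/
theorem not_continuousOn_of_eq_jump {U : Set unitInterval} (hU : IsOpen U) (hm : mid ∈ U)
    {Λ' : unitInterval → Circle} (he : ∀ x ∈ U \ {mid}, Λ' x = jump x) : ¬ ContinuousOn Λ' U := by
  intro hc
  have hUm : U ∈ 𝓝 mid := hU.mem_nhds hm
  have hca : Tendsto Λ' (𝓝 mid) (𝓝 (Λ' mid)) := hc.continuousAt hUm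
  have h1 : Λ' mid = 1 := by
    refine tendsto_nhds_unique (hca.mono_left (nhdsWithin_le_nhds (s := Set.Iio mid))) ?_
    refine tendsto_const_nhds.congr' ?_
    filter_upwards [jump_eventually_left, nhdsWithin_le_nhds hUm, self_mem_nhdsWithin]
      with x hx hxU hxm
    rw [he x ⟨hxU, ne_of_lt hxm⟩, hx]
  have h2 : Λ' mid = -1 := by
    refine tendsto_nhds_unique (hca.mono_left (nhdsWithin_le_nhds (s := Set.Ioi mid))) ?_
    refine tendsto_const_nhds.congr' ?_
    filter_upwards [jump_eventually_right, nhdsWithin_le_nhds hUm, self_mem_nhdsWithin]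
      with x hx hxU hxm
    rw [he x ⟨hxU, ne_of_gt hxm⟩, hx]
  exact one_ne_neg_one_circle (h1.symm.trans h2)

theorem reg_jump : reg jump = {mid}ᶜ := by
  refine reg_eq_compl_mid (fun x hx => ContinuousAt.continuousWithinAt ?_) ?_
  · rcases lt_or_gt_of_ne (show x ≠ mid from hx) with h | h
    · refine (continuousAt_const (y := (1 : Circle))).congr ?_
      filter_upwards [isOpen_Iio.mem_nhds h] with y hy using (if_pos hy).symm
    · refine (continuousAt_const (y := (-1 : Circle))).congr ?_
      filter_upwards [isOpen_Ioi.mem_nhds h] with y hy using (if_neg (not_lt.2 (le_of_lt hy))).symm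
  · rintro ⟨U, hU, hm, hc⟩
    exact not_continuousOn_of_eq_jump hU hm (fun _ _ => rfl) hc

theorem reg_removable : reg removable = {mid}ᶜ := by
  refine reg_eq_compl_mid (fun x hx => ContinuousAt.continuousWithinAt ?_) ?_
  · refine (continuousAt_const (y := (1 : Circle))).congr ?_
    filter_upwards [isOpen_compl_singleton.mem_nhds hx] with y hy using (if_neg hy).symm
  · rintro ⟨U, hU, hm, hc⟩
    have hca : Tendsto removable (𝓝 mid) (𝓝 (removable mid)) := hc.continuousAt (hU.mem_nhds hm)
    have h1 : removable mid = 1 := by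
      refine tendsto_nhds_unique (hca.mono_left (nhdsWithin_le_nhds (s := {mid}ᶜ))) ?_
      refine tendsto_const_nhds.congr' ?_
      filter_upwards [removable_eventually] with x hx using hx.symm
    exact one_ne_neg_one_circle (h1.symm.trans (if_pos rfl))

theorem ssuppR_jump : ssuppR jump = {mid} := by
  rw [ssuppR, ssupp, frontier_compl, reg_jump, frontier_compl_mid, sdiff_eq_left,
    Set.disjoint_singleton_left]
  rintro ⟨-, U, hU, hm, Λ', hc, he⟩
  refine not_continuousOn_of_eq_jump hU hm (fun x hx => he x ⟨hx.1, ?_⟩) hc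
  rw [reg_jump]
  exact hx.2

theorem regInfty_removable : regInfty removable = {mid} := by
  ext x
  rw [regInfty, Set.mem_ofPred_eq, reg_removable, frontier_compl_mid]
  -- The constant 1 is an extension on the whole interval.
  refine and_iff_left_of_imp fun _ => ⟨Set.univ, isOpen_univ, Set.mem_univ _, fun _ => 1,
    continuousOn_const, fun q hq => ?_⟩
  exact (if_neg hq.2).symm

theorem measurable_coe_jump : Measurable fun x => (jump x : ℂ) := by
  have : (fun x => (jump x : ℂ)) = fun x => if x < mid then (1 : ℂ) else -1 := by
    funext x
    rw [jump]
    split_ifs <;> rfl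
  rw [this]
  exact Measurable.ite measurableSet_Iio measurable_const measurable_const

theorem measurable_coe_removable : Measurable fun x => (removable x : ℂ) := by
  have : (fun x => (removable x : ℂ)) = fun x => if x = mid then (-1 : ℂ) else 1 := by
    funext x
    rw [removable]
    split_ifs <;> rfl
  rw [this]
  exact Measurable.ite (measurableSet_singleton mid) measurable_const measurable_const

end UnitInterval

theorem mulRep_self_injective {X : Type v} [TopologicalSpace X] [MeasurableSpace X] [BorelSpace X]
    {H : Type u} [NormedAddCommGroup H] [InnerProductSpace ℂ H] [CompleteSpace H]
    (B : DeficiencyOne H) (μ : Measure X) [IsFiniteMeasure μ] [μ.IsOpenPosMeasure] :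
    Function.Injective (mulRep ℂ μ) ∧ Function.Injective (mulRep H μ) :=
  ⟨mulRep_injective one_ne_zero, mulRep_injective B.φp_ne_zero⟩

/-- A function on `[0, 1]` whose regular set is the complement of the midpoint gives rise to a
closed semiregular operator with selfadjoint localization. -/
theorem unitInterval_example {H : Type} [NormedAddCommGroup H] [InnerProductSpace ℂ H]
    [CompleteSpace H] [TopologicalSpace.SeparableSpace H] (B : DeficiencyOne H)
    {Λ : unitInterval → Circle} (hΛ : Measurable fun x => (Λ x : ℂ)) (hreg : reg Λ = {mid}ᶜ) :
    closure (reg Λ) = Set.univ ∧ frontier (reg Λ) = {mid} ∧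
      Dense ((localize (volume : Measure unitInterval) (TLam B Λ)).domain :
          Set (Lp H 2 (volume : Measure unitInterval))) ∧
        (localize (volume : Measure unitInterval) (TLam B Λ)).adjoint =
          localize (volume : Measure unitInterval) (TLam B Λ) := by
  have hμ : (volume : Measure unitInterval) (reg Λ)ᶜ = 0 := by
    rw [hreg, compl_compl]; exact measure_singleton mid
  refine ⟨?_, ?_, dense_domain_localize_TLam B hμ, adjoint_localize_TLam B hΛ hμ⟩
  · rw [hreg, closure_compl_mid]
  · rw [hreg, frontier_compl_mid]

end ModuleLocalization

end

open ModuleLocalization in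
theorem proposition6 :
    -- the main statement, for all data `H`, `D`, `φ₊`, `φ₋`, `X`, `Λ`, `μ`
    (∀ (H : Type u) [NormedAddCommGroup H] [InnerProductSpace ℂ H] [CompleteSpace H]
        [TopologicalSpace.SeparableSpace H] (B : DeficiencyOne H)
        (X : Type v) [TopologicalSpace X] [T2Space X] [LocallyCompactSpace X]
        [MeasurableSpace X] [BorelSpace X]
        (Λ : X → Circle) (_ : Measurable fun x => (Λ x : ℂ)) (_ : closure (reg Λ) = Set.univ)
        (μ : Measure X) [IsProbabilityMeasure μ] [μ.Regular]
        (_ : μ.support = Set.univ) (_ : μ (frontier (reg Λ)) = 0),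
      -- `π_μ` is faithful, both as the cyclic representation and on `L²(X, μ; H)`
      (Function.Injective (mulRep ℂ μ) ∧ Function.Injective (mulRep H μ)) ∧
      -- `T_Λ` is a closed semiregular operator
      ((TLam B Λ).IsClosed ∧ IsSemiregular (TLam B Λ)) ∧
      -- the localization is selfadjoint
      (Dense ((localize μ (TLam B Λ)).domain : Set (Lp H 2 μ)) ∧
        (localize μ (TLam B Λ)).adjoint = localize μ (TLam B Λ)) ∧
      -- first description of its domain
      (∀ f : Lp H 2 μ, f ∈ (localize μ (TLam B Λ)).domain ↔
        f ∈ (localize μ (Tmax B X)).domain ∧ ∀ᵐ x ∂μ, f x ∈ (B.ext (Λ x)).domain) ∧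
      -- second description of its domain
      (∃ η : (localize μ (Tmax B X)).domain,
        ((η : Lp H 2 μ) : X → H) =ᵐ[μ] (fun x => (B.etaPerp (Λ x) : H)) ∧
        ∀ f : Lp H 2 μ, f ∈ (localize μ (TLam B Λ)).domain ↔
          ∃ hf : f ∈ (localize μ (Tmax B X)).domain,
            ∀ᵐ x ∂μ, fiberGraphInner (localize μ (Tmax B X)) ⟨f, hf⟩ η x = 0) ∧
      -- `T_Λ` itself, in the two extreme cases
      (frontier (reg Λ) = ssuppR Λ → (frontier (reg Λ)).Nonempty →
        IsModuleSelfAdjoint (TLam B Λ) ∧ ¬ IsRegular (TLam B Λ)) ∧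
      (frontier (reg Λ) = regInfty Λ → (frontier (reg Λ)).Nonempty →
        ¬ IsModuleSelfAdjoint (TLam B Λ) ∧ ¬ IsRegular (TLam B Λ))) ∧
    -- both cases occur, on `X = [0, 1]` with Lebesgue measure
    (∃ (H : Type) (_ : NormedAddCommGroup H) (_ : InnerProductSpace ℂ H) (_ : CompleteSpace H)
        (_ : TopologicalSpace.SeparableSpace H) (B : DeficiencyOne H),
      Function.Injective (mulRep ℂ (volume : Measure unitInterval)) ∧
      Function.Injective (mulRep H (volume : Measure unitInterval)) ∧
      (∃ Λ : unitInterval → Circle, Measurable (fun x => (Λ x : ℂ)) ∧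
        (TLam B Λ).IsClosed ∧ IsSemiregular (TLam B Λ) ∧
        IsModuleSelfAdjoint (TLam B Λ) ∧ ¬ IsRegular (TLam B Λ) ∧
        Dense ((localize (volume : Measure unitInterval) (TLam B Λ)).domain :
          Set (Lp H 2 (volume : Measure unitInterval))) ∧
        (localize (volume : Measure unitInterval) (TLam B Λ)).adjoint =
          localize (volume : Measure unitInterval) (TLam B Λ)) ∧
      (∃ Λ : unitInterval → Circle, Measurable (fun x => (Λ x : ℂ)) ∧
        (TLam B Λ).IsClosed ∧ IsSemiregular (TLam B Λ) ∧
        ¬ IsModuleSelfAdjoint (TLam B Λ) ∧ ¬ IsRegular (TLam B Λ) ∧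
        Dense ((localize (volume : Measure unitInterval) (TLam B Λ)).domain :
          Set (Lp H 2 (volume : Measure unitInterval))) ∧
        (localize (volume : Measure unitInterval) (TLam B Λ)).adjoint =
          localize (volume : Measure unitInterval) (TLam B Λ))) := by
  refine ⟨?_, ?_⟩
  · intro H _ _ _ _ B X _ _ _ _ _ Λ hΛ hreg μ _ _ hsupp hfr
    have := isOpenPosMeasure_of_support_eq_univ hsupp
    rw [frontier_reg hreg] at hfr
    refine ⟨mulRep_self_injective B μ, ⟨isClosed_TLam B Λ, isSemiregular_TLam B Λ⟩,
      ⟨dense_domain_localize_TLam B hfr, adjoint_localize_TLam B hΛ hfr⟩,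
      mem_domain_localize_TLam_iff B hfr, exists_eta B hΛ hfr, fun h hne => ?_, fun h hne => ?_⟩
    · exact ⟨isModuleSelfAdjoint_TLam B hreg h, not_isRegular_TLam_of_ssuppR B hreg (h ▸ hne)⟩
    · exact ⟨not_isModuleSelfAdjoint_TLam B hreg (h ▸ hne),
        not_isRegular_TLam_of_regInfty B hreg (h ▸ hne)⟩
  · obtain ⟨B⟩ := nonempty_deficiencyOne_L2
    have hsep := separableSpace_L2
    obtain ⟨h1, h2⟩ := mulRep_self_injective B (volume : Measure unitInterval)
    obtain ⟨c1, f1, d1, a1⟩ := unitInterval_example B measurable_coe_jump reg_jump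
    obtain ⟨c2, f2, d2, a2⟩ := unitInterval_example B measurable_coe_removable reg_removable
    refine ⟨_, _, _, _, hsep, B, h1, h2,
      ⟨jump, measurable_coe_jump, isClosed_TLam B _, isSemiregular_TLam B _,
        isModuleSelfAdjoint_TLam B c1 (f1.trans ssuppR_jump.symm),
        not_isRegular_TLam_of_ssuppR B c1 ?_, d1, a1⟩,
      ⟨removable, measurable_coe_removable, isClosed_TLam B _, isSemiregular_TLam B _,
        not_isModuleSelfAdjoint_TLam B c2 ?_, not_isRegular_TLam_of_regInfty B c2 ?_, d2, a2⟩⟩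
    · rw [ssuppR_jump]; exact Set.singleton_nonempty mid
    · rw [regInfty_removable]; exact Set.singleton_nonempty mid
    · rw [regInfty_removable]; exact Set.singleton_nonempty mid
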